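/- **Setting.** Consider $x_{k+1}=Ax_k+Bu_k+Dw_k$ with $x_k\in\mathbb R^{n_x}$, $u_k\in\mathbb R^{n_u}$ and i.i.d. zero-mean disturbances $w_k$, whose law is supported in a bounded set $W\subset\mathbb R^{n_w}$ that contains the origin in its interior. Let $Q,R\succ0$ and let $P\succeq 0$ satisfy the algebraic Riccati equation $P=Q+A^\top PA-K^\top(R+B^\top PB)K$, $K=-(R+B^\top PB)^{-1}B^\top PA$ (so that $A+BK$ is Schur stable). Let $N\ge1$ and let $L_1,\dots,L_{N-1}$ be given disturbance feedback gains. For an initial state $x$ and a decision vector $c=(c_0,\dots,c_{N-1})\in\mathbb R^{Nn_u}$ the predictions are $x_0=x$, $x_{i+1}=Ax_i+Bu_i+Dw_i$ with $$u_i=Kx_i+c_i+\sum_{j=1}^{i}L_jw_{i-j}\quad(0\le i\le N-1),\qquad u_i=Kx_i+\sum_{j=1}^{N-1}L_jw_{i-j}\quad(i\ge N).$$ There are finitely many chance constraints, with data $f_r\in\mathbb R^{n_x}$, $g_r\in\mathbb R^{n_u}$, $p_r\in(0,1]$. The constraint at step $i$ is: for all past disturbances $w_0,\dots,w_{i-1}\in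 W$ and every $r$, the probability over $w_i$ that $f_r^\top x_{i+1}+g_r^\top u_i\le1$ is at least $p_r$. The vector $c$ is feasible at $x$ if the constraints hold at all steps $0\le i\le N+N_2-1$, where $N_2$ is large enough that they then hold at all steps $i\ge0$. Let $\mathbf X$ be the set of states at which some $c$ is feasible, assumed bounded and non-empty. The cost is $$J(x,c)=\sum_{i=0}^\infty\bigl(\mathbb E\{x_i^\top Qx_i+u_i^\top Ru_i\}-L_{ss}\bigr),\qquad L_{ss}=\lim_{i\to\infty}\mathbb E\{x_i^\top Qx_i+u_i^\top Ru_i\};$$ $c^*(x)$ denotes the minimizer of $J(x,\cdot)$ over the feasible $c$, with first block $c_0^*(x)$, and the closed loop is $x^+=(A+BK)x+Bc_0^*(x)+Dw$. **Proposition.** $L_{ss}$ exists and does not depend on $(x,c)$, the series defining $J$ converges, and for every $x\in\mathbf X$ the minimizer $c^*(x)$ exists and is unique and the nominal successor $(A+BK)x+Bc^*_0(x)$ lies in $\mathbf X$. There are matrices $P_x,P_c\succ0$ and a constant $\kappa$ such that: (i) $J(x,c)=x^\top P_xx+c^\top P_cc+\kappa$ for all $x,c$; in particular minimizing $J$ over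 the feasible $c$ is equivalent to minimizing $x^\top P_xx+c^\top P_cc$. (ii) With $V(x)=x^\top P_xx+c^*(x)^\top P_cc^*(x)$, the nominal value function difference $\Delta(x,0)=V\bigl((A+BK)x+Bc^*_0(x)\bigr)-V(x)$ satisfies, for all $x\in\mathbf X$, $$\Delta(x,0)\le-\begin{bmatrix}x\\c_0^*(x)\end{bmatrix}^\top\begin{bmatrix}Q+K^\top RK&K^\top R\\RK&R\end{bmatrix}\begin{bmatrix}x\\c_0^*(x)\end{bmatrix}.$$ (iii) $V$ is strictly convex on $\mathbf X$, positive definite ($0\in\mathbf X$, $V(0)=0$, and $V(x)>0$ for $x\in\mathbf X\setminus\{0\}$) and Lipschitz continuous on $\mathbf X$. Moreover there are $P_x,P_c\succ0$, for which minimizing $x^\top P_xx+c^\top P_cc$ over the feasible $c$ is again equivalent to minimizing $J$ (without equality up to a constant), such that the corresponding $V$ satisfies (iii) and satisfies (ii) with the lower right block $R$ replaced by $R+B^\top P_xB$. -/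

import Mathlib

open MeasureTheory ProbabilityTheory Filter Topology Matrix

/-- Data of a striped affine-in-the-disturbance stochastic MPC problem for
`x⁺ = A x + B u + D w` (`nx` states, `nu` inputs, `nw` disturbances, `nc` scalar chance
constraints, prediction horizon `N`). -/
structure StripedMPC (nx nu nw nc N : ℕ) where
  A : Matrix (Fin nx) (Fin nx) ℝ
  B : Matrix (Fin nx) (Fin nu) ℝ
  D : Matrix (Fin nx) (Fin nw) ℝ
  /-- stage cost weights -/
  Q : Matrix (Fin nx) (Fin nx) ℝ
  R : Matrix (Fin nu) (Fin nu) ℝ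
  /-- solution of the algebraic Riccati equation -/
  P : Matrix (Fin nx) (Fin nx) ℝ
  /-- state feedback gain -/
  K : Matrix (Fin nu) (Fin nx) ℝ
  /-- disturbance feedback gains; only `L 1, …, L (N - 1)` are used -/
  L : ℕ → Matrix (Fin nu) (Fin nw) ℝ
  /-- the `r`-th constraint is `ℙ (f r ⬝ x⁺ + g r ⬝ u ≤ 1) ≥ p r` -/
  f : Fin nc → Fin nx → ℝ
  g : Fin nc → Fin nu → ℝ
  p : Fin nc → ℝ
  /-- the constraints are imposed at the prediction steps `0, …, N + N₂ - 1` -/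
  N₂ : ℕ
  /-- disturbance set -/
  W : Set (Fin nw → ℝ)
  /-- probability law of each disturbance -/
  ν : Measure (Fin nw → ℝ)

namespace StripedMPC

variable {nx nu nw nc N : ℕ} (S : StripedMPC nx nu nw nc N)

/-- The block `c_i` of the stacked decision vector `c = (c_0, …, c_{N-1})`, and `0` for `i ≥ N`. -/
def blk (c : Fin N × Fin nu → ℝ) (i : ℕ) : Fin nu → ℝ :=
  fun l => if h : i < N then c (⟨i, h⟩, l) else 0

/-- The predicted input at step `i` when the predicted state at step `i` is `xi` and the disturbance
sequence is `v`: it is `K xi + c_i + ∑_{j=1}^{i} L_j v_{i-j}` if `i ≤ N - 1`, and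
`K xi + ∑_{j=1}^{N-1} L_j v_{i-j}` if `i ≥ N`. -/
def policy (c : Fin N × Fin nu → ℝ) (v : ℕ → Fin nw → ℝ) (i : ℕ) (xi : Fin nx → ℝ) :
    Fin nu → ℝ :=
  S.K *ᵥ xi + blk c i + ∑ j ∈ Finset.Icc 1 (min i (N - 1)), S.L j *ᵥ v (i - j)

/-- The predicted state `x_i`, from the initial state `x` and the disturbance sequence `v`. -/
def predState (x : Fin nx → ℝ) (c : Fin N × Fin nu → ℝ) (v : ℕ → Fin nw → ℝ) : ℕ → Fin nx → ℝ
  | 0 => x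
  | i + 1 => S.A *ᵥ predState x c v i + S.B *ᵥ S.policy c v i (predState x c v i) + S.D *ᵥ v i

/-- The predicted input `u_i`. -/
def predInput (x : Fin nx → ℝ) (c : Fin N × Fin nu → ℝ) (v : ℕ → Fin nw → ℝ) (i : ℕ) :
    Fin nu → ℝ :=
  S.policy c v i (S.predState x c v i)

/-- The chance constraints at prediction step `i`: for all past disturbances in `W` (`x_i` and `u_i`
depend on `v 0, …, v (i - 1)` only), the probability over the disturbance `w` acting at step `i`
that `f_r ⬝ x_{i+1} + g_r ⬝ u_i ≤ 1` is at least `p_r`. -/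
def StepConstraint (x : Fin nx → ℝ) (c : Fin N × Fin nu → ℝ) (i : ℕ) : Prop :=
  ∀ r : Fin nc, ∀ v : ℕ → Fin nw → ℝ, (∀ j, v j ∈ S.W) →
    S.p r ≤ S.ν.real {w | S.f r ⬝ᵥ (S.A *ᵥ S.predState x c v i + S.B *ᵥ S.predInput x c v i
      + S.D *ᵥ w) + S.g r ⬝ᵥ S.predInput x c v i ≤ 1}

/-- `c` satisfies the constraints of the optimal control problem with initial state `x`. -/
def Feasible (x : Fin nx → ℝ) (c : Fin N × Fin nu → ℝ) : Prop :=
  ∀ i < N + S.N₂, S.StepConstraint x c i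

/-- The set of states at which the optimal control problem is feasible. -/
def X : Set (Fin nx → ℝ) := {x | ∃ c, S.Feasible x c}

/-- The standing assumptions. For `Q, R ≻ 0` the positive semidefinite solution of the Riccati
equation is the one whose gain `K` makes `A + B K` Schur stable. -/
structure Standing : Prop where
  N_pos : 0 < N
  Q_pos : S.Q.PosDef
  R_pos : S.R.PosDef
  P_psd : S.P.PosSemidef
  riccati : S.P = S.Q + S.Aᵀ * S.P * S.A - S.Kᵀ * (S.R + S.Bᵀ * S.P * S.B) * S.K
  gain : S.K = -((S.R + S.Bᵀ * S.P * S.B)⁻¹ * S.Bᵀ * S.P * S.A)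
  p_pos : ∀ r, 0 < S.p r
  p_le : ∀ r, S.p r ≤ 1
  W_bdd : Bornology.IsBounded S.W
  W_zero : (0 : Fin nw → ℝ) ∈ interior S.W
  ν_prob : IsProbabilityMeasure S.ν
  ν_supp : ∀ᵐ w ∂S.ν, w ∈ S.W
  ν_mean : ∫ w, w ∂S.ν = 0
  /-- `N₂` is large enough to ensure constraint satisfaction over the infinite horizon -/
  horizon : ∀ x c, S.Feasible x c → ∀ i, S.StepConstraint x c i
  X_bdd : Bornology.IsBounded S.X
  X_nonempty : S.X.Nonempty

section Cost

variable {Ω : Type*} [MeasurableSpace Ω] (μ : Measure Ω) (w : ℕ → Ω → Fin nw → ℝ)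

/-- The random predicted stage cost `x_iᵀ Q x_i + u_iᵀ R u_i`. -/
def stage (x : Fin nx → ℝ) (c : Fin N × Fin nu → ℝ) (i : ℕ) (ω : Ω) : ℝ :=
  S.predState x c (fun j => w j ω) i ⬝ᵥ S.Q *ᵥ S.predState x c (fun j => w j ω) i
    + S.predInput x c (fun j => w j ω) i ⬝ᵥ S.R *ᵥ S.predInput x c (fun j => w j ω) i

/-- The expected predicted stage cost. -/
noncomputable def expStage (x : Fin nx → ℝ) (c : Fin N × Fin nu → ℝ) (i : ℕ) : ℝ :=
  ∫ ω, S.stage w x c i ω ∂μ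

/-- The steady-state expected stage cost of the predictions (computed for `x = 0`, `c = 0`). -/
noncomputable def Lss : ℝ := limUnder atTop (S.expStage μ w 0 0)

/-- The predicted cost `J`: the sum over `i` of the expectation of stage cost minus `Lss`. -/
noncomputable def cost (x : Fin nx → ℝ) (c : Fin N × Fin nu → ℝ) : ℝ :=
  ∑' i, (S.expStage μ w x c i - S.Lss μ w)

/-- `c` solves the optimal control problem at the state `x`. -/
def IsOptimal (x : Fin nx → ℝ) (c : Fin N × Fin nu → ℝ) : Prop :=
  S.Feasible x c ∧ ∀ c', S.Feasible x c' → S.cost μ w x c ≤ S.cost μ w x c'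

open Classical in
/-- The optimal solution `c*(x)` (and `0` if there is none). -/
noncomputable def optC (x : Fin nx → ℝ) : Fin N × Fin nu → ℝ :=
  if h : ∃ c, S.IsOptimal μ w x c then h.choose else 0

/-- The closed-loop map `(x, w) ↦ (A + B K) x + B c*_0(x) + D w`. -/
noncomputable def closedLoop (x : Fin nx → ℝ) (d : Fin nw → ℝ) : Fin nx → ℝ :=
  (S.A + S.B * S.K) *ᵥ x + S.B *ᵥ blk (S.optC μ w x) 0 + S.D *ᵥ d

/-- The quadratic function `xᵀ Px x + cᵀ Pc c`. -/
def quad (Px : Matrix (Fin nx) (Fin nx) ℝ) (Pc : Matrix (Fin N × Fin nu) (Fin N × Fin nu) ℝ)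
    (x : Fin nx → ℝ) (c : Fin N × Fin nu → ℝ) : ℝ :=
  x ⬝ᵥ Px *ᵥ x + c ⬝ᵥ Pc *ᵥ c

/-- `Px, Pc ≻ 0`, and under the constraints of the optimal control problem, minimizing `J` over `c`
is equivalent to minimizing `xᵀ Px x + cᵀ Pc c` over `c`, at every state `x`. -/
structure IsEquivalentCost (Px : Matrix (Fin nx) (Fin nx) ℝ)
    (Pc : Matrix (Fin N × Fin nu) (Fin N × Fin nu) ℝ) : Prop where
  Px_pos : Px.PosDef
  Pc_pos : Pc.PosDef
  equiv : ∀ x c, S.IsOptimal μ w x c ↔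
    S.Feasible x c ∧ ∀ c', S.Feasible x c' → quad Px Pc x c ≤ quad Px Pc x c'

/-- The value function `V(x) = xᵀ Px x + c*(x)ᵀ Pc c*(x)`. -/
noncomputable def value (Px : Matrix (Fin nx) (Fin nx) ℝ)
    (Pc : Matrix (Fin N × Fin nu) (Fin N × Fin nu) ℝ) (x : Fin nx → ℝ) : ℝ :=
  quad Px Pc x (S.optC μ w x)

/-- The value function difference `Δ(x, d) = V(x⁺) - V(x)`. -/
noncomputable def valueDiff (Px : Matrix (Fin nx) (Fin nx) ℝ)
    (Pc : Matrix (Fin N × Fin nu) (Fin N × Fin nu) ℝ) (x : Fin nx → ℝ) (d : Fin nw → ℝ) : ℝ :=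
  S.value μ w Px Pc (S.closedLoop μ w x d) - S.value μ w Px Pc x

/-- The quadratic form of `[[Q + Kᵀ R K, Kᵀ R], [R K, Y]]` at `(x, c*_0(x))`. -/
noncomputable def decreaseForm (Y : Matrix (Fin nu) (Fin nu) ℝ) (x : Fin nx → ℝ) : ℝ :=
  Sum.elim x (blk (S.optC μ w x) 0) ⬝ᵥ
    (Matrix.fromBlocks (S.Q + S.Kᵀ * S.R * S.K) (S.Kᵀ * S.R) (S.R * S.K) Y) *ᵥ
      Sum.elim x (blk (S.optC μ w x) 0)

end Cost

/-- `V` is strictly convex, positive definite and Lipschitz continuous on `s`. -/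
structure IsRegularOn (V : (Fin nx → ℝ) → ℝ) (s : Set (Fin nx → ℝ)) : Prop where
  strictConvex : StrictConvexOn ℝ s V
  zero_mem : (0 : Fin nx → ℝ) ∈ s
  map_zero : V 0 = 0
  pos : ∀ x ∈ s, x ≠ 0 → 0 < V x
  lipschitz : ∃ C : NNReal, LipschitzOnWith C V s

end StripedMPC

/-!
Superposition splits every prediction into a nominal part, which depends linearly on `(x, c)`, and a
convolution of the disturbances, which does not depend on `(x, c)` (`predState_eq`,
`predInput_eq`). As the disturbances are independent with mean zero, the expected stage cost is the
nominal stage cost plus `∑ k < i, noiseStage k` (`Standing.expStage_eq`).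

The Riccati equation completes the square (`Standing.cost_to_go`): under `u = K x + c`, the
cost-to-go `xᵀ P x` at the successor plus the stage cost equals `xᵀ P x + cᵀ (R + Bᵀ P B) c`. This
gives three things. `A + B K` is a strict contraction in the norm of `P`
(`Standing.exists_contraction`), so `noiseStage` decays geometrically, and the limit `Lss` exists and
is approached summably fast. The nominal stage costs telescope to `xᵀ P x + cᵀ H c` with `H` block
diagonal with blocks `R + Bᵀ P B` (`Standing.hasSum_nomStage`), so `J` is this form plus a constant.
And the decrease of the value function follows from comparing the optimizer at the nominal successor
with the shifted optimizer, which is feasible there because a zero disturbance is admissible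
(`Standing.feasible_shift`). For the sharper decrease the pair `(P, 2 H)` works: minimizers do not
change, and the second copy of `c₀ᵀ (R + Bᵀ P B) c₀` dominates `c₀ᵀ Bᵀ P B c₀`.

A chance constraint is an upper bound on an affine function of `(x, c)` and of the past disturbances,
so the feasible set is a polyhedron in `(x, c)` (`Standing.exists_linear_constraints`). Convexity
gives strict convexity of the value function; closedness gives existence of the optimizer and, since
nominal trajectories with eventually zero decisions tend to the origin, feasibility of the origin.
Lipschitz continuity needs polyhedrality: Fourier–Motzkin elimination shows that the solution set of
linear inequalities is Lipschitz in the parameter (`exists_lipschitz_selection`).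
-/

/-! ### Quadratic forms -/

section QuadraticForms

variable {m n : Type*} [Fintype m] [Fintype n]

theorem Matrix.PosDef.form_pos {M : Matrix n n ℝ} (hM : M.PosDef) {x : n → ℝ} (hx : x ≠ 0) :
    0 < x ⬝ᵥ M *ᵥ x := by
  simpa using hM.dotProduct_mulVec_pos hx

theorem Matrix.PosSemidef.form_nonneg {M : Matrix n n ℝ} (hM : M.PosSemidef) (x : n → ℝ) :
    0 ≤ x ⬝ᵥ M *ᵥ x := by
  simpa using hM.dotProduct_mulVec_nonneg x

theorem Matrix.IsHermitian.form_comm {M : Matrix n n ℝ} (hM : M.IsHermitian) (x y : n → ℝ) :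
    x ⬝ᵥ M *ᵥ y = y ⬝ᵥ M *ᵥ x := by
  have h : Mᵀ = M := by simpa [Matrix.conjTranspose_eq_transpose_of_trivial] using hM.eq
  rw [dotProduct_mulVec, ← mulVec_transpose, h, dotProduct_comm]

/-- Moving a factor of the matrix of a bilinear form onto the left argument. -/
theorem form_transpose_mul (B : Matrix m n ℝ) (M : Matrix m m ℝ) (x : n → ℝ) (y : m → ℝ) :
    x ⬝ᵥ (Bᵀ * M) *ᵥ y = (B *ᵥ x) ⬝ᵥ M *ᵥ y := by
  rw [← mulVec_mulVec, dotProduct_mulVec, vecMul_transpose]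

theorem continuous_form (M : Matrix n n ℝ) : Continuous fun x : n → ℝ => x ⬝ᵥ M *ᵥ x := by
  fun_prop

theorem form_smul (M : Matrix n n ℝ) (a : ℝ) (x : n → ℝ) :
    (a • x) ⬝ᵥ M *ᵥ (a • x) = a ^ 2 * (x ⬝ᵥ M *ᵥ x) := by
  simp only [mulVec_smul, smul_dotProduct, dotProduct_smul, smul_eq_mul]
  ring

theorem exists_form_le (M : Matrix n n ℝ) : ∃ C : ℝ, 0 < C ∧ ∀ x : n → ℝ,
    x ⬝ᵥ M *ᵥ x ≤ C * ‖x‖ ^ 2 := by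
  obtain ⟨C, hC⟩ := (isCompact_sphere (0 : n → ℝ) 1).bddAbove_image
    (continuous_form M).continuousOn
  refine ⟨max C 1, by positivity, fun x => ?_⟩
  rcases eq_or_ne x 0 with rfl | hx
  · simp
  have hx' : ‖x‖ ≠ 0 := norm_ne_zero_iff.2 hx
  have h := hC ⟨‖x‖⁻¹ • x, by simp [norm_smul, hx'], rfl⟩
  have h2 := form_smul M ‖x‖ (‖x‖⁻¹ • x)
  rw [smul_smul, mul_inv_cancel₀ hx', one_smul] at h2
  rw [h2, mul_comm]
  exact mul_le_mul_of_nonneg_right (h.trans (le_max_left _ _)) (by positivity)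

theorem Matrix.PosDef.exists_le_form {M : Matrix n n ℝ} (hM : M.PosDef) : ∃ c : ℝ, 0 < c ∧
    ∀ x : n → ℝ, c * ‖x‖ ^ 2 ≤ x ⬝ᵥ M *ᵥ x := by
  rcases isEmpty_or_nonempty n with hn | hn
  · exact ⟨1, one_pos, fun x => by simp [Subsingleton.elim x 0]⟩
  obtain ⟨y, hy, hmin⟩ := (isCompact_sphere (0 : n → ℝ) 1).exists_isMinOn
    (NormedSpace.sphere_nonempty.2 zero_le_one) (continuous_form M).continuousOn
  have hy0 : y ≠ 0 := by
    rintro rfl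
    simp at hy
  refine ⟨y ⬝ᵥ M *ᵥ y, hM.form_pos hy0, fun x => ?_⟩
  rcases eq_or_ne x 0 with rfl | hx
  · simp
  have hx' : ‖x‖ ≠ 0 := norm_ne_zero_iff.2 hx
  have h : y ⬝ᵥ M *ᵥ y ≤ (‖x‖⁻¹ • x) ⬝ᵥ M *ᵥ (‖x‖⁻¹ • x) :=
    hmin (by simp [norm_smul, hx'] : ‖x‖⁻¹ • x ∈ Metric.sphere (0 : n → ℝ) 1)
  have h2 := form_smul M ‖x‖ (‖x‖⁻¹ • x)
  rw [smul_smul, mul_inv_cancel₀ hx', one_smul] at h2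
  rw [h2, mul_comm]
  exact mul_le_mul_of_nonneg_left h (by positivity)

/-- The convexity defect of a quadratic form along a segment is a multiple of its value at the
difference of the endpoints. -/
theorem form_convex_comb {M : Matrix n n ℝ} (hM : M.IsHermitian) {a b : ℝ} (hab : a + b = 1)
    (x y : n → ℝ) :
    (a • x + b • y) ⬝ᵥ M *ᵥ (a • x + b • y)
      = a * (x ⬝ᵥ M *ᵥ x) + b * (y ⬝ᵥ M *ᵥ y) - a * b * ((x - y) ⬝ᵥ M *ᵥ (x - y)) := by
  obtain rfl : b = 1 - a := by linarith
  simp only [mulVec_smul, smul_dotProduct, dotProduct_smul, smul_eq_mul, mulVec_add,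
    add_dotProduct, dotProduct_add, mulVec_sub, sub_dotProduct, dotProduct_sub,
    hM.form_comm y x]
  ring

/-- On bounded sets a quadratic form is Lipschitz. -/
theorem exists_form_sub_le (M : Matrix n n ℝ) (r : ℝ) : ∃ C : ℝ, 0 ≤ C ∧ ∀ x y : n → ℝ,
    ‖x‖ ≤ r → ‖y‖ ≤ r → y ⬝ᵥ M *ᵥ y - x ⬝ᵥ M *ᵥ x ≤ C * ‖y - x‖ := by
  have hd : ContDiff ℝ 1 fun x : n → ℝ => x ⬝ᵥ M *ᵥ x := by
    simp only [dotProduct, mulVec]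
    fun_prop
  obtain ⟨K, hK⟩ := hd.contDiffOn.exists_lipschitzOnWith (s := Metric.closedBall (0 : n → ℝ) r)
    one_ne_zero (convex_closedBall _ _) (isCompact_closedBall _ _)
  refine ⟨K, K.2, fun x y hx hy => ?_⟩
  have := hK.dist_le_mul y (by simpa using hy) x (by simpa using hx)
  rw [Real.dist_eq, dist_eq_norm] at this
  exact (le_abs_self _).trans this

end QuadraticForms

/-! ### The Riccati equation -/

namespace StripedMPC

variable {nx nu nw nc N : ℕ} {S : StripedMPC nx nu nw nc N}

/-- The Hessian of the one-step cost-to-go in the perturbation `c` of the control `K x + c`. -/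
def hess (S : StripedMPC nx nu nw nc N) : Matrix (Fin nu) (Fin nu) ℝ := S.R + S.Bᵀ * S.P * S.B

theorem form_hess (u : Fin nu → ℝ) :
    u ⬝ᵥ S.hess *ᵥ u = u ⬝ᵥ S.R *ᵥ u + (S.B *ᵥ u) ⬝ᵥ S.P *ᵥ (S.B *ᵥ u) := by
  rw [hess, add_mulVec, dotProduct_add, ← mulVec_mulVec, form_transpose_mul]

namespace Standing

theorem hess_posDef (hS : S.Standing) : S.hess.PosDef := by
  have h := hS.P_psd.conjTranspose_mul_mul_same S.B
  rw [Matrix.conjTranspose_eq_transpose_of_trivial] at h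
  exact hS.R_pos.add_posSemidef h

theorem hess_mul_gain (hS : S.Standing) : S.hess * S.K = -(S.Bᵀ * S.P * S.A) := by
  have hu := (Matrix.isUnit_iff_isUnit_det _).1 hS.hess_posDef.isUnit
  have h := hS.gain
  change S.K = -(S.hess⁻¹ * S.Bᵀ * S.P * S.A) at h
  rw [h, Matrix.mul_neg, Matrix.mul_assoc, Matrix.mul_assoc,
    Matrix.mul_nonsing_inv_cancel_left _ _ hu, Matrix.mul_assoc]

theorem form_P (hS : S.Standing) (x : Fin nx → ℝ) :
    x ⬝ᵥ S.P *ᵥ x = x ⬝ᵥ S.Q *ᵥ x + (S.A *ᵥ x) ⬝ᵥ S.P *ᵥ (S.A *ᵥ x)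
      - (S.K *ᵥ x) ⬝ᵥ S.hess *ᵥ (S.K *ᵥ x) := by
  conv_lhs => rw [hS.riccati]
  rw [sub_mulVec, add_mulVec, dotProduct_sub, dotProduct_add, ← mulVec_mulVec, form_transpose_mul,
    ← mulVec_mulVec, form_transpose_mul]
  rfl

/-- Completing the square with the Riccati equation: under the input `K x + c`, cost-to-go plus
stage cost exceed `xᵀ P x` exactly by `cᵀ (R + Bᵀ P B) c`. -/
theorem cost_to_go (hS : S.Standing) (x : Fin nx → ℝ) (c : Fin nu → ℝ) :
    (S.A *ᵥ x + S.B *ᵥ (S.K *ᵥ x + c)) ⬝ᵥ S.P *ᵥ (S.A *ᵥ x + S.B *ᵥ (S.K *ᵥ x + c))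
      + (x ⬝ᵥ S.Q *ᵥ x + (S.K *ᵥ x + c) ⬝ᵥ S.R *ᵥ (S.K *ᵥ x + c))
      = x ⬝ᵥ S.P *ᵥ x + c ⬝ᵥ S.hess *ᵥ c := by
  have hG := hS.hess_posDef.isHermitian.form_comm
  have hP := hS.P_psd.isHermitian.form_comm
  obtain ⟨u, hu⟩ : ∃ u, u = S.K *ᵥ x + c := ⟨_, rfl⟩
  have hc : c = u - S.K *ᵥ x := by simp [hu]
  have hcross : (S.B *ᵥ u) ⬝ᵥ S.P *ᵥ (S.A *ᵥ x) = -(u ⬝ᵥ S.hess *ᵥ (S.K *ᵥ x)) := by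
    rw [← form_transpose_mul, mulVec_mulVec x, mulVec_mulVec x, hS.hess_mul_gain, neg_mulVec,
      dotProduct_neg, neg_neg]
  have h1 := hS.form_P x
  have h2 := form_hess (S := S) u
  rw [← hu, hc]
  simp only [mulVec_add, mulVec_sub, add_dotProduct, sub_dotProduct, dotProduct_add,
    dotProduct_sub, hP (S.A *ᵥ x) (S.B *ᵥ u), hG (S.K *ᵥ x) u]
  linarith

theorem P_posDef (hS : S.Standing) : S.P.PosDef := by
  refine .of_dotProduct_mulVec_pos hS.P_psd.isHermitian fun x hx => ?_
  have h := hS.cost_to_go x 0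
  simp only [add_zero, zero_dotProduct] at h
  have h1 := hS.P_psd.form_nonneg (S.A *ᵥ x + S.B *ᵥ (S.K *ᵥ x))
  have h2 := hS.R_pos.posSemidef.form_nonneg (S.K *ᵥ x)
  have h3 := hS.Q_pos.form_pos hx
  simp only [star_trivial]
  linarith

/-- `A + B K` is a strict contraction in the norm of `P`, hence Schur stable. -/
theorem exists_contraction (hS : S.Standing) : ∃ ρ : ℝ, 0 < ρ ∧ ρ < 1 ∧ ∀ x : Fin nx → ℝ,
    (S.A *ᵥ x + S.B *ᵥ (S.K *ᵥ x)) ⬝ᵥ S.P *ᵥ (S.A *ᵥ x + S.B *ᵥ (S.K *ᵥ x))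
      ≤ ρ * (x ⬝ᵥ S.P *ᵥ x) := by
  obtain ⟨C, hC, hCP⟩ := exists_form_le S.P
  obtain ⟨q, hq, hqQ⟩ := hS.Q_pos.exists_le_form
  have hε : 0 < q / (C + q) := by positivity
  have hε1 : q / (C + q) < 1 := (div_lt_one (by positivity)).2 (by linarith)
  refine ⟨1 - q / (C + q), by linarith, by linarith, fun x => ?_⟩
  have h := hS.cost_to_go x 0
  simp only [add_zero, zero_dotProduct] at h
  have h2 := hS.R_pos.posSemidef.form_nonneg (S.K *ᵥ x)
  have h3 : q / (C + q) * (x ⬝ᵥ S.P *ᵥ x) ≤ x ⬝ᵥ S.Q *ᵥ x := by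
    calc q / (C + q) * (x ⬝ᵥ S.P *ᵥ x) ≤ q / (C + q) * ((C + q) * ‖x‖ ^ 2) := by
          refine mul_le_mul_of_nonneg_left ((hCP x).trans ?_) hε.le
          nlinarith [sq_nonneg ‖x‖]
      _ = q * ‖x‖ ^ 2 := by field_simp
      _ ≤ _ := hqQ x
  linarith

end Standing

end StripedMPC

/-! ### Lipschitz dependence of the solutions of linear inequalities -/

section Polyhedra

/-- Interpolation between finitely many lower and upper bounds, staying `δ`-close to a given point
which violates each of them by at most `δ`. -/
theorem exists_near_between {κ κ' : Type*} [Fintype κ] [Fintype κ'] (l : κ → ℝ) (u : κ' → ℝ)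
    (t δ : ℝ) (hδ : 0 ≤ δ) (hlu : ∀ i j, l i ≤ u j) (hl : ∀ i, l i ≤ t + δ)
    (hu : ∀ j, t - δ ≤ u j) : ∃ s, (∀ i, l i ≤ s) ∧ (∀ j, s ≤ u j) ∧ |s - t| ≤ δ := by
  let l' : Option κ → ℝ := fun o => o.elim (t - δ) l
  have hs : ∀ o, l' o ≤ Finset.univ.sup' ⟨none, Finset.mem_univ _⟩ l' :=
    fun o => Finset.le_sup' l' (Finset.mem_univ o)
  refine ⟨Finset.univ.sup' ⟨none, Finset.mem_univ _⟩ l', fun i => hs (some i), fun j => ?_, ?_⟩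
  · refine Finset.sup'_le _ _ fun o _ => ?_
    cases o with
    | none => exact hu j
    | some i => exact hlu i j
  · have h1 : t - δ ≤ _ := hs none
    have h2 : Finset.univ.sup' ⟨none, Finset.mem_univ _⟩ l' ≤ t + δ := by
      refine Finset.sup'_le _ _ fun o _ => ?_
      cases o with
      | none => change t - δ ≤ t + δ; linarith
      | some i => exact hl i
    rw [abs_le]
    constructor <;> linarith

/-- Solutions of a finite system of linear inequalities depend on the parameter in a Lipschitz way:
a solution at `x` can be moved to a solution at `y`, if there is one, over a distance at most
`C ‖x - y‖`. The proof is Fourier–Motzkin elimination of the last variable. -/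
theorem exists_lipschitz_selection_fin {E : Type*} [NormedAddCommGroup E] [NormedSpace ℝ E]
    (n : ℕ) :
    ∀ {ι : Type} [Finite ι] (F : ι → E →L[ℝ] ℝ) (G : ι → (Fin n → ℝ) →L[ℝ] ℝ) (b : ι → ℝ),
    ∃ C : ℝ, 0 ≤ C ∧ ∀ x y c, (∀ k, F k x + G k c ≤ b k) → (∃ d, ∀ k, F k y + G k d ≤ b k) →
      ∃ d, (∀ k, F k y + G k d ≤ b k) ∧ ‖d - c‖ ≤ C * ‖y - x‖ := by
  induction n with
  | zero =>
    intro ι _ F G b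
    refine ⟨0, le_rfl, fun x y c _ ⟨d, hd⟩ => ⟨d, hd, ?_⟩⟩
    simp [Subsingleton.elim d c]
  | succ n ih =>
    intro ι _ F G b
    cases nonempty_fintype ι
    classical
    -- coefficient of the eliminated variable, and the remaining part of each functional
    let e : (Fin n → ℝ) × ℝ →L[ℝ] (Fin (n + 1) → ℝ) :=
      ContinuousLinearMap.pi (Fin.lastCases (ContinuousLinearMap.snd ℝ _ _)
        fun i => (ContinuousLinearMap.proj i).comp (ContinuousLinearMap.fst ℝ _ _))
    have he : ∀ c t, e (c, t) = Fin.snoc c t := by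
      intro c t
      ext i
      refine Fin.lastCases ?_ (fun i => ?_) i <;> simp [e]
    let h : ι → ℝ := fun k => G k (e (0, 1))
    let G' : ι → (Fin n → ℝ) →L[ℝ] ℝ := fun k =>
      ((G k).comp e).comp (ContinuousLinearMap.inl ℝ _ _)
    have hG : ∀ k c t, G k (Fin.snoc c t) = G' k c + h k * t := by
      intro k c t
      have : ((c, t) : (Fin n → ℝ) × ℝ) = (c, 0) + t • (0, 1) := by simp
      rw [← he, this, map_add, map_add, map_smul, map_smul, smul_eq_mul, mul_comm t]
      rfl
    let ι' := {k // h k = 0} ⊕ ({k // 0 < h k} × {k // h k < 0})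
    let F₁ : ι' → E →L[ℝ] ℝ :=
      Sum.elim (fun k => F k) fun q => (-h q.2) • F q.1 + h q.1 • F q.2
    let G₁ : ι' → (Fin n → ℝ) →L[ℝ] ℝ :=
      Sum.elim (fun k => G' k) fun q => (-h q.2) • G' q.1 + h q.1 • G' q.2
    let b₁ : ι' → ℝ := Sum.elim (fun k => b k) fun q => -h q.2 * b q.1 + h q.1 * b q.2
    obtain ⟨C, hC, H⟩ := ih F₁ G₁ b₁
    have elim : ∀ x c t, (∀ k, F k x + G k (Fin.snoc c t) ≤ b k) →
        ∀ k, F₁ k x + G₁ k c ≤ b₁ k := by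
      rintro x c t hx (⟨k, hk⟩ | ⟨⟨k, hk⟩, ⟨l, hl⟩⟩)
      · have := hx k
        rw [hG, hk] at this
        simpa [F₁, G₁, b₁] using this
      · have h1 := mul_le_mul_of_nonneg_left (hx k) (neg_nonneg.2 hl.le)
        have h2 := mul_le_mul_of_nonneg_left (hx l) hk.le
        simp only [hG] at h1 h2
        simp only [F₁, G₁, b₁, Sum.elim_inr, _root_.add_apply, _root_.smul_apply,
          smul_eq_mul]
        linarith
    -- Lipschitz constants of the bounds on the eliminated variable
    let D : ι → ℝ := fun k => |h k|⁻¹ * (‖F k‖ + ‖G' k‖ * C)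
    have hD : ∀ k, 0 ≤ D k := fun k => by positivity
    have hDs : ∀ k, D k ≤ ∑ k, D k := fun k =>
      Finset.single_le_sum (fun k _ => hD k) (Finset.mem_univ k)
    refine ⟨max C (∑ k, D k), le_max_of_le_left hC, fun x y c hx ⟨d, hd⟩ => ?_⟩
    rw [← Fin.snoc_init_self c] at hx
    rw [← Fin.snoc_init_self d] at hd
    obtain ⟨d', hd', hdist⟩ := H x y (Fin.init c) (elim _ _ _ hx) ⟨_, elim _ _ _ hd⟩
    set t := c (Fin.last n) with ht
    have hδ : 0 ≤ (∑ k, D k) * ‖y - x‖ :=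
      mul_nonneg (Finset.sum_nonneg fun k _ => hD k) (norm_nonneg _)
    -- the value at which constraint `k` becomes active, at `y`
    let β : ι → ℝ := fun k => (b k - F k y - G' k d') / h k
    have key : ∀ k, h k ≠ 0 → |(F k x + G' k (Fin.init c)) - (F k y + G' k d')| ≤
        |h k| * ((∑ k, D k) * ‖y - x‖) := by
      intro k hk
      have h1 : |F k (y - x)| ≤ ‖F k‖ * ‖y - x‖ := (F k).le_opNorm _
      have h2 : |G' k (d' - Fin.init c)| ≤ ‖G' k‖ * (C * ‖y - x‖) :=
        ((G' k).le_opNorm _).trans (mul_le_mul_of_nonneg_left hdist (norm_nonneg _))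
      have h3 : |h k| * (D k * ‖y - x‖) = ‖F k‖ * ‖y - x‖ + ‖G' k‖ * (C * ‖y - x‖) := by
        have := abs_ne_zero.2 hk
        simp only [D]
        field_simp
      have h4 : |h k| * (D k * ‖y - x‖) ≤ |h k| * ((∑ k, D k) * ‖y - x‖) := by
        gcongr
        exact hDs k
      calc _ = |F k (y - x) + G' k (d' - Fin.init c)| := by
            rw [abs_sub_comm, map_sub, map_sub]
            congr 1
            ring
        _ ≤ _ := abs_add_le _ _
        _ ≤ _ := by linarith
    obtain ⟨s, hs1, hs2, hs3⟩ := exists_near_between (fun k : {k // h k < 0} => β k)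
      (fun k : {k // 0 < h k} => β k) t _ hδ
      (by
        rintro ⟨l, hl⟩ ⟨k, hk⟩
        have := hd' (.inr (⟨k, hk⟩, ⟨l, hl⟩))
        simp only [F₁, G₁, b₁, Sum.elim_inr, _root_.add_apply, _root_.smul_apply,
          smul_eq_mul] at this
        rw [div_le_iff_of_neg hl, div_mul_eq_mul_div, div_le_iff₀ hk]
        linarith)
      (by
        rintro ⟨l, hl⟩
        have h1 := key l hl.ne
        have h2 := hx l
        rw [abs_of_neg hl, abs_le] at h1
        rw [hG] at h2
        rw [div_le_iff_of_neg hl]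
        linarith)
      (by
        rintro ⟨k, hk⟩
        have h1 := key k hk.ne'
        have h2 := hx k
        rw [abs_of_pos hk, abs_le] at h1
        rw [hG] at h2
        rw [le_div_iff₀ hk]
        linarith)
    refine ⟨Fin.snoc d' s, fun k => ?_, ?_⟩
    · rw [hG]
      rcases lt_trichotomy (h k) 0 with hk | hk | hk
      · have := hs1 ⟨k, hk⟩
        rw [div_le_iff_of_neg hk] at this
        linarith
      · have := hd' (.inl ⟨k, hk⟩)
        simp only [F₁, G₁, b₁, Sum.elim_inl] at this
        rw [hk]
        linarith
      · have := hs2 ⟨k, hk⟩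
        rw [le_div_iff₀ hk] at this
        linarith
    · refine (pi_norm_le_iff_of_nonneg (by positivity)).2 fun i => ?_
      refine Fin.lastCases ?_ (fun i => ?_) i
      · simp only [Pi.sub_apply, Fin.snoc_last, Real.norm_eq_abs]
        exact hs3.trans (by gcongr; exact le_max_right _ _)
      · have h1 := (norm_le_pi_norm (d' - Fin.init c) i).trans hdist
        simp only [Pi.sub_apply, Fin.snoc_castSucc]
        exact h1.trans (by gcongr; exact le_max_left _ _)

/-- `exists_lipschitz_selection_fin` with the unknowns indexed by an arbitrary finite type. -/
theorem exists_lipschitz_selection {E κ : Type*} [NormedAddCommGroup E] [NormedSpace ℝ E]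
    [Fintype κ] {ι : Type} [Finite ι] (F : ι → E →L[ℝ] ℝ) (G : ι → (κ → ℝ) →L[ℝ] ℝ) (b : ι → ℝ) :
    ∃ C : ℝ, 0 ≤ C ∧ ∀ x y c, (∀ k, F k x + G k c ≤ b k) → (∃ d, ∀ k, F k y + G k d ≤ b k) →
      ∃ d, (∀ k, F k y + G k d ≤ b k) ∧ ‖d - c‖ ≤ C * ‖y - x‖ := by
  let e := Fintype.equivFin κ
  let T : (Fin (Fintype.card κ) → ℝ) →L[ℝ] (κ → ℝ) :=
    ContinuousLinearMap.pi fun i => ContinuousLinearMap.proj (e i)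
  have hT : ∀ c, T (c ∘ e.symm) = c := fun c => by
    ext i
    simp [T]
  obtain ⟨C, hC, h⟩ := exists_lipschitz_selection_fin _ F (fun k => (G k).comp T) b
  refine ⟨C, hC, fun x y c hx ⟨d, hd⟩ => ?_⟩
  obtain ⟨d', hd', hdist⟩ := h x y (c ∘ e.symm) (fun k => by simpa [hT] using hx k)
    ⟨d ∘ e.symm, fun k => by simpa [hT] using hd k⟩
  refine ⟨T d', hd', le_trans ?_ hdist⟩
  refine (pi_norm_le_iff_of_nonneg (norm_nonneg _)).2 fun i => ?_
  simpa [T] using norm_le_pi_norm (d' - c ∘ e.symm) (e i)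

end Polyhedra

/-! ### Superposition and shifting of the predictions -/

namespace StripedMPC

variable {nx nu nw nc N : ℕ} (S : StripedMPC nx nu nw nc N)

/-- The gain from the disturbance `v (i - j)` to the feedforward term of the input at step `i`. -/
def stripe (j : ℕ) : Matrix (Fin nu) (Fin nw) ℝ := if j ≤ N - 1 then S.L j else 0

/-- The gain from the disturbance `v (i - (k + 1))` to the predicted state at step `i`. -/
def stateResp : ℕ → Matrix (Fin nx) (Fin nw) ℝ
  | 0 => S.D
  | k + 1 => S.A * stateResp k + S.B * (S.K * stateResp k + S.stripe (k + 1))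

/-- The gain from the disturbance `v (i - (k + 1))` to the predicted input at step `i`. -/
def inputResp (k : ℕ) : Matrix (Fin nu) (Fin nw) ℝ := S.K * S.stateResp k + S.stripe (k + 1)

/-- With the gains cut off after `N - 1`, the feedforward term is a convolution with the same form at
every step. -/
theorem sum_stripe (v : ℕ → Fin nw → ℝ) (i : ℕ) :
    ∑ j ∈ Finset.Icc 1 (min i (N - 1)), S.L j *ᵥ v (i - j)
      = ∑ k ∈ Finset.range i, S.stripe (k + 1) *ᵥ v (i - (k + 1)) := by
  have h : Finset.Icc 1 (min i (N - 1)) = (Finset.Icc 1 i).filter (· ≤ N - 1) := by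
    ext j
    simp only [Finset.mem_Icc, Finset.mem_filter, le_min_iff]
    tauto
  rw [h, Finset.sum_filter, Finset.range_eq_Ico,
    Finset.sum_Ico_add' (fun k => S.stripe k *ᵥ v (i - k)) 0 i 1]
  refine Finset.sum_congr (by ext; simp) fun j _ => ?_
  rw [stripe]
  split_ifs <;> simp

theorem policy_eq (c : Fin N × Fin nu → ℝ) (v : ℕ → Fin nw → ℝ) (i : ℕ) (xi : Fin nx → ℝ) :
    S.policy c v i xi = S.K *ᵥ xi + blk c i
      + ∑ k ∈ Finset.range i, S.stripe (k + 1) *ᵥ v (i - (k + 1)) := by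
  rw [policy, sum_stripe]

theorem predInput_zero (x : Fin nx → ℝ) (c : Fin N × Fin nu → ℝ) (i : ℕ) :
    S.predInput x c 0 i = S.K *ᵥ S.predState x c 0 i + blk c i := by
  simp [predInput, policy]

theorem predState_zero_succ (x : Fin nx → ℝ) (c : Fin N × Fin nu → ℝ) (i : ℕ) :
    S.predState x c 0 (i + 1) = S.A *ᵥ S.predState x c 0 i
      + S.B *ᵥ (S.K *ᵥ S.predState x c 0 i + blk c i) := by
  rw [predState, ← predInput_zero]
  simp [predInput]

/-- Superposition: the predicted state is the nominal one plus a time-invariant convolution of the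
disturbances. -/
theorem predState_eq (x : Fin nx → ℝ) (c : Fin N × Fin nu → ℝ) (v : ℕ → Fin nw → ℝ) (i : ℕ) :
    S.predState x c v i = S.predState x c 0 i
      + ∑ k ∈ Finset.range i, S.stateResp k *ᵥ v (i - (k + 1)) := by
  induction i with
  | zero => simp [predState]
  | succ i ih =>
    rw [predState_zero_succ, predState, policy_eq, ih, Finset.sum_range_succ']
    simp only [stateResp, add_mulVec, ← mulVec_mulVec, mulVec_add, Finset.sum_add_distrib,
      mulVec_sum, Nat.add_sub_add_right, Nat.add_sub_cancel, zero_add]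
    abel

theorem predInput_eq (x : Fin nx → ℝ) (c : Fin N × Fin nu → ℝ) (v : ℕ → Fin nw → ℝ) (i : ℕ) :
    S.predInput x c v i = S.predInput x c 0 i
      + ∑ k ∈ Finset.range i, S.inputResp k *ᵥ v (i - (k + 1)) := by
  rw [predInput_zero, predInput, policy_eq, predState_eq]
  simp only [inputResp, add_mulVec, ← mulVec_mulVec, mulVec_add, Finset.sum_add_distrib, mulVec_sum]
  abel

theorem stripe_eq_zero {j : ℕ} (h : N ≤ j) (hj : 0 < j) : S.stripe j = 0 := by
  rw [stripe, if_neg (by omega)]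

theorem blk_eq_zero (c : Fin N × Fin nu → ℝ) {i : ℕ} (h : N ≤ i) : blk c i = 0 := by
  ext l
  simp [blk, Nat.not_lt.2 h]

theorem blk_smul_add (a b : ℝ) (c d : Fin N × Fin nu → ℝ) (i : ℕ) :
    blk (a • c + b • d) i = a • blk c i + b • blk d i := by
  ext l
  simp only [blk, Pi.add_apply, Pi.smul_apply, smul_eq_mul]
  split_ifs <;> simp

theorem predState_zero_smul_add (a b : ℝ) (x y : Fin nx → ℝ) (c d : Fin N × Fin nu → ℝ) (i : ℕ) :
    S.predState (a • x + b • y) (a • c + b • d) 0 i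
      = a • S.predState x c 0 i + b • S.predState y d 0 i := by
  induction i with
  | zero => simp [predState]
  | succ i ih =>
    simp only [predState_zero_succ, ih, blk_smul_add, mulVec_add, mulVec_smul, smul_add]
    abel

/-- The nominal predicted state as a linear map of the initial state and the decision vector. -/
def nomState (i : ℕ) : (Fin nx → ℝ) × (Fin N × Fin nu → ℝ) →ₗ[ℝ] (Fin nx → ℝ) where
  toFun p := S.predState p.1 p.2 0 i
  map_add' p q := by simpa using S.predState_zero_smul_add 1 1 p.1 q.1 p.2 q.2 i
  map_smul' a p := by simpa using S.predState_zero_smul_add a 0 p.1 0 p.2 0 i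

/-- The nominal predicted input as a linear map of the initial state and the decision vector. -/
def nomInput (i : ℕ) : (Fin nx → ℝ) × (Fin N × Fin nu → ℝ) →ₗ[ℝ] (Fin nu → ℝ) where
  toFun p := S.predInput p.1 p.2 0 i
  map_add' p q := by
    have h := S.predState_zero_smul_add 1 1 p.1 q.1 p.2 q.2 i
    have h' := blk_smul_add 1 1 p.2 q.2 i
    simp only [one_smul] at h h'
    simp only [predInput_zero, Prod.fst_add, Prod.snd_add, h, h', mulVec_add]
    abel
  map_smul' a p := by
    have h := S.predState_zero_smul_add a 0 p.1 0 p.2 0 i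
    have h' := blk_smul_add a 0 p.2 0 i
    simp only [zero_smul, add_zero] at h h'
    simp [predInput_zero, h, h', mulVec_smul]

/-- The decision vector with the first block dropped and a zero block appended. -/
def shift (c : Fin N × Fin nu → ℝ) : Fin N × Fin nu → ℝ := fun q => blk c (q.1 + 1) q.2

theorem blk_shift (c : Fin N × Fin nu → ℝ) (i : ℕ) : blk (shift c) i = blk c (i + 1) := by
  ext l
  by_cases h : i < N
  · simp [blk, shift, h]
  · rw [blk_eq_zero _ (by omega), blk_eq_zero _ (by omega)]

/-- The nominal successor state under the first block of `c`. -/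
def succState (x : Fin nx → ℝ) (c : Fin N × Fin nu → ℝ) : Fin nx → ℝ :=
  S.A *ᵥ x + S.B *ᵥ (S.K *ᵥ x + blk c 0)

/-- The disturbance sequence `v`, delayed by one step and started with `0`. -/
def delay (v : ℕ → Fin nw → ℝ) : ℕ → Fin nw → ℝ
  | 0 => 0
  | i + 1 => v i

/-- Shifting the decision vector amounts to delaying the disturbances: the additional disturbance
feedback term at step `i + 1` multiplies the initial zero disturbance. -/
theorem policy_shift (c : Fin N × Fin nu → ℝ) (v : ℕ → Fin nw → ℝ) (i : ℕ) (z : Fin nx → ℝ) :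
    S.policy (shift c) v i z = S.policy c (delay v) (i + 1) z := by
  rw [policy_eq, policy_eq, blk_shift, Finset.sum_range_succ]
  simp only [Nat.add_sub_add_right, Nat.sub_self, delay, mulVec_zero, add_zero]
  congr 1
  refine Finset.sum_congr rfl fun k hk => ?_
  obtain ⟨m, hm⟩ : ∃ m, i - k = m + 1 := ⟨i - k - 1, by have := Finset.mem_range.1 hk; omega⟩
  rw [hm, show i - (k + 1) = m by omega]

/-- The predictions made at the nominal successor state with the shifted decision vector are those
made one step earlier, with first disturbance zero. -/
theorem predState_shift (x : Fin nx → ℝ) (c : Fin N × Fin nu → ℝ) (v : ℕ → Fin nw → ℝ) (i : ℕ) :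
    S.predState (S.succState x c) (shift c) v i = S.predState x c (delay v) (i + 1) := by
  induction i with
  | zero => simp [predState, succState, policy, delay]
  | succ i ih => rw [predState, ih, policy_shift]; rfl

end StripedMPC

/-! ### Second moments of the disturbances -/

section Moments

variable {d : ℕ} {ν : Measure (Fin d → ℝ)}
  {Ω : Type*} [MeasurableSpace Ω] {μ : Measure Ω} [IsProbabilityMeasure μ]
  {w : ℕ → Ω → Fin d → ℝ}

theorem memLp_coord (hν : ∃ r, ∀ᵐ v ∂ν, ‖v‖ ≤ r) (hlaw : ∀ i, HasLaw (w i) ν μ) (j : ℕ)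
    (a : Fin d) : MemLp (fun ω => w j ω a) 2 μ := by
  obtain ⟨r, hr⟩ := hν
  have h : ∀ᵐ ω ∂μ, ‖w j ω‖ ≤ r := by
    rw [← (hlaw j).map_eq] at hr
    exact ae_of_ae_map (hlaw j).aemeasurable hr
  refine MemLp.of_bound ((measurable_pi_apply a).comp_aemeasurable
    (hlaw j).aemeasurable).aestronglyMeasurable r ?_
  filter_upwards [h] with ω hω using (norm_le_pi_norm _ a).trans hω

theorem integral_coord (hν : ∃ r, ∀ᵐ v ∂ν, ‖v‖ ≤ r) (hmean : ∫ v, v ∂ν = 0)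
    (hlaw : ∀ i, HasLaw (w i) ν μ) (j : ℕ) (a : Fin d) : ∫ ω, w j ω a ∂μ = 0 := by
  have hint : ∀ a, Integrable (fun ω => w j ω a) μ := fun a =>
    (memLp_coord hν hlaw j a).integrable (by norm_num)
  have h : ∫ ω, w j ω ∂μ = 0 := by rw [(hlaw j).integral_eq, hmean]
  rw [← eval_integral hint a, h]
  rfl

theorem integrable_form (hν : ∃ r, ∀ᵐ v ∂ν, ‖v‖ ≤ r) (hlaw : ∀ i, HasLaw (w i) ν μ)
    (M : Matrix (Fin d) (Fin d) ℝ) (j k : ℕ) :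
    Integrable (fun ω => w j ω ⬝ᵥ M *ᵥ w k ω) μ := by
  simp only [dotProduct, mulVec, Finset.mul_sum]
  refine integrable_finsetSum _ fun a _ => integrable_finsetSum _ fun b _ => ?_
  exact (memLp_coord hν hlaw j a).integrable_mul ((memLp_coord hν hlaw k b).const_mul _)

theorem integral_form_of_ne (hν : ∃ r, ∀ᵐ v ∂ν, ‖v‖ ≤ r) (hmean : ∫ v, v ∂ν = 0)
    (hindep : iIndepFun w μ) (hlaw : ∀ i, HasLaw (w i) ν μ)
    (M : Matrix (Fin d) (Fin d) ℝ) {j k : ℕ} (hjk : j ≠ k) :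
    ∫ ω, w j ω ⬝ᵥ M *ᵥ w k ω ∂μ = 0 := by
  have hi : ∀ a b, Integrable (fun ω => w j ω a * (M a b * w k ω b)) μ := fun a b =>
    (memLp_coord hν hlaw j a).integrable_mul ((memLp_coord hν hlaw k b).const_mul _)
  simp only [dotProduct, mulVec, Finset.mul_sum]
  rw [integral_finsetSum _ fun a _ => integrable_finsetSum _ fun b _ => hi a b]
  refine Finset.sum_eq_zero fun a _ => ?_
  rw [integral_finsetSum _ fun b _ => hi a b]
  refine Finset.sum_eq_zero fun b _ => ?_
  have h : IndepFun (fun ω => w j ω a) (fun ω => w k ω b) μ :=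
    (hindep.indepFun hjk).comp (measurable_pi_apply a) (measurable_pi_apply b)
  have h2 := h.integral_fun_mul_eq_mul_integral (memLp_coord hν hlaw j a).aestronglyMeasurable
    (memLp_coord hν hlaw k b).aestronglyMeasurable
  rw [integral_coord hν hmean hlaw, zero_mul] at h2
  simp only [mul_left_comm _ (M a b)]
  rw [integral_const_mul, h2, mul_zero]

theorem integrable_dotProduct (hν : ∃ r, ∀ᵐ v ∂ν, ‖v‖ ≤ r) (hlaw : ∀ i, HasLaw (w i) ν μ)
    (a : Fin d → ℝ) (j : ℕ) : Integrable (fun ω => a ⬝ᵥ w j ω) μ := by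
  simp only [dotProduct]
  exact integrable_finsetSum _ fun b _ =>
    ((memLp_coord hν hlaw j b).integrable (by norm_num)).const_mul _

theorem integral_dotProduct (hν : ∃ r, ∀ᵐ v ∂ν, ‖v‖ ≤ r) (hmean : ∫ v, v ∂ν = 0)
    (hlaw : ∀ i, HasLaw (w i) ν μ) (a : Fin d → ℝ) (j : ℕ) : ∫ ω, a ⬝ᵥ w j ω ∂μ = 0 := by
  simp only [dotProduct]
  rw [integral_finsetSum _ fun b _ =>
    ((memLp_coord hν hlaw j b).integrable (by norm_num)).const_mul _]
  exact Finset.sum_eq_zero fun b _ => by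
    rw [integral_const_mul, integral_coord hν hmean hlaw, mul_zero]

/-- The expectation of a quadratic form of an affine function of the disturbances: the mean
contributes its own value, and by independence only the diagonal second moments survive. -/
theorem integral_form_add_sum {n : ℕ} (hν : ∃ r, ∀ᵐ v ∂ν, ‖v‖ ≤ r) (hmean : ∫ v, v ∂ν = 0)
    (hindep : iIndepFun w μ) (hlaw : ∀ i, HasLaw (w i) ν μ) (M : Matrix (Fin n) (Fin n) ℝ)
    (z : Fin n → ℝ) (T : ℕ → Matrix (Fin n) (Fin d) ℝ) (i : ℕ) :
    Integrable (fun ω => (z + ∑ k ∈ Finset.range i, T k *ᵥ w (i - (k + 1)) ω) ⬝ᵥ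
        M *ᵥ (z + ∑ k ∈ Finset.range i, T k *ᵥ w (i - (k + 1)) ω)) μ ∧
      ∫ ω, (z + ∑ k ∈ Finset.range i, T k *ᵥ w (i - (k + 1)) ω) ⬝ᵥ
        M *ᵥ (z + ∑ k ∈ Finset.range i, T k *ᵥ w (i - (k + 1)) ω) ∂μ
      = z ⬝ᵥ M *ᵥ z + ∑ k ∈ Finset.range i, ∫ v, (T k *ᵥ v) ⬝ᵥ M *ᵥ (T k *ᵥ v) ∂ν := by
  have hexp : ∀ ω, (z + ∑ k ∈ Finset.range i, T k *ᵥ w (i - (k + 1)) ω) ⬝ᵥ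
      M *ᵥ (z + ∑ k ∈ Finset.range i, T k *ᵥ w (i - (k + 1)) ω)
      = z ⬝ᵥ M *ᵥ z
        + ((∑ k ∈ Finset.range i, (z ᵥ* M ᵥ* T k) ⬝ᵥ w (i - (k + 1)) ω)
        + (∑ k ∈ Finset.range i, ((M *ᵥ z) ᵥ* T k) ⬝ᵥ w (i - (k + 1)) ω)
        + ∑ k ∈ Finset.range i, ∑ l ∈ Finset.range i,
          w (i - (k + 1)) ω ⬝ᵥ ((T k)ᵀ * M * T l) *ᵥ w (i - (l + 1)) ω) := by
    intro ω
    have h1 : ∀ k, (z ᵥ* M ᵥ* T k) ⬝ᵥ w (i - (k + 1)) ω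
        = z ⬝ᵥ M *ᵥ (T k *ᵥ w (i - (k + 1)) ω) := fun k => by
      rw [dotProduct_mulVec, dotProduct_mulVec]
    have h2 : ∀ k, ((M *ᵥ z) ᵥ* T k) ⬝ᵥ w (i - (k + 1)) ω
        = (T k *ᵥ w (i - (k + 1)) ω) ⬝ᵥ M *ᵥ z := fun k => by
      rw [← dotProduct_mulVec, dotProduct_comm]
    have h3 : ∀ k l, w (i - (k + 1)) ω ⬝ᵥ ((T k)ᵀ * M * T l) *ᵥ w (i - (l + 1)) ω
        = (T k *ᵥ w (i - (k + 1)) ω) ⬝ᵥ M *ᵥ (T l *ᵥ w (i - (l + 1)) ω) := fun k l => by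
      rw [← mulVec_mulVec, form_transpose_mul]
    simp only [h1, h2, h3, add_dotProduct, mulVec_add, dotProduct_add, mulVec_sum, dotProduct_sum,
      sum_dotProduct, Finset.sum_add_distrib]
    rw [Finset.sum_comm (s := Finset.range i) (t := Finset.range i)]
    ring
  have hi1 := integrable_finsetSum (Finset.range i) fun k _ =>
    integrable_dotProduct hν hlaw (z ᵥ* M ᵥ* T k) (i - (k + 1))
  have hi2 := integrable_finsetSum (Finset.range i) fun k _ =>
    integrable_dotProduct hν hlaw ((M *ᵥ z) ᵥ* T k) (i - (k + 1))
  have hi3' := fun k => integrable_finsetSum (Finset.range i) fun l _ =>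
    integrable_form hν hlaw ((T k)ᵀ * M * T l) (i - (k + 1)) (i - (l + 1))
  have hi3 := integrable_finsetSum (Finset.range i) fun k _ => hi3' k
  simp only [hexp]
  refine ⟨(integrable_const _).fun_add ((hi1.fun_add hi2).fun_add hi3), ?_⟩
  rw [integral_add (integrable_const _) ((hi1.fun_add hi2).fun_add hi3),
    integral_add (hi1.fun_add hi2) hi3, integral_add hi1 hi2,
    integral_finsetSum _ fun k _ => integrable_dotProduct hν hlaw _ _,
    integral_finsetSum _ fun k _ => integrable_dotProduct hν hlaw _ _,
    integral_finsetSum _ fun k _ => hi3' k]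
  simp only [integral_dotProduct hν hmean hlaw, integral_const, probReal_univ, one_smul,
    Finset.sum_const_zero, zero_add]
  congr 1
  refine Finset.sum_congr rfl fun k hk => ?_
  rw [integral_finsetSum _ fun l _ => integrable_form hν hlaw _ _ _, Finset.sum_eq_single k]
  · have h : ∀ v : Fin d → ℝ, (T k *ᵥ v) ⬝ᵥ M *ᵥ (T k *ᵥ v) = v ⬝ᵥ ((T k)ᵀ * M * T k) *ᵥ v :=
      fun v => by rw [← mulVec_mulVec, form_transpose_mul]
    simp only [h]
    exact (hlaw (i - (k + 1))).integral_comp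
      (f := fun v => v ⬝ᵥ ((T k)ᵀ * M * T k) *ᵥ v) (continuous_form _).aestronglyMeasurable
  · intro l hl hlk
    have h1 := Finset.mem_range.1 hk
    have h2 := Finset.mem_range.1 hl
    exact integral_form_of_ne hν hmean hindep hlaw _ (by omega)
  · exact fun h => absurd hk h

end Moments

/-! ### The predicted cost -/

/-- A sequence whose increments eventually decay geometrically converges summably fast. -/
theorem exists_tendsto_summable_of_geometric {s : ℕ → ℝ} {C ρ : ℝ} (hρ : 0 ≤ ρ) (hρ1 : ρ < 1)
    (N : ℕ) (h : ∀ i, |s (i + 1 + N) - s (i + N)| ≤ C * ρ ^ i) :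
    ∃ l, Tendsto s atTop (𝓝 l) ∧ Summable fun i => s i - l := by
  have hd : ∀ i, dist (s (i + N)) (s (i + 1 + N)) ≤ C * ρ ^ i := fun i => by
    rw [dist_comm, Real.dist_eq]
    exact h i
  obtain ⟨l, hl⟩ := cauchySeq_tendsto_of_complete (cauchySeq_of_le_geometric ρ C hρ1 hd)
  refine ⟨l, (tendsto_add_atTop_iff_nat N).1 hl, (summable_nat_add_iff N).1 ?_⟩
  refine Summable.of_norm_bounded (g := fun i => C / (1 - ρ) * ρ ^ i)
    ((summable_geometric_of_lt_one hρ hρ1).mul_left _) fun i => ?_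
  have := dist_le_of_le_geometric_of_tendsto ρ C hρ1 hd hl i
  rw [Real.dist_eq] at this
  rw [Real.norm_eq_abs]
  exact this.trans_eq (by ring)

namespace StripedMPC

open scoped Kronecker

variable {nx nu nw nc N : ℕ} {S : StripedMPC nx nu nw nc N}

/-- The Hessian of the predicted cost in the stacked decision vector: block diagonal with all blocks
equal to `R + Bᵀ P B`. -/
def costHess (S : StripedMPC nx nu nw nc N) : Matrix (Fin N × Fin nu) (Fin N × Fin nu) ℝ :=
  (1 : Matrix (Fin N) (Fin N) ℝ) ⊗ₖ S.hess

theorem form_costHess (c : Fin N × Fin nu → ℝ) :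
    c ⬝ᵥ S.costHess *ᵥ c = ∑ i ∈ Finset.range N, blk c i ⬝ᵥ S.hess *ᵥ blk c i := by
  rw [Finset.sum_range]
  simp only [dotProduct, Fintype.sum_prod_type, costHess, mulVec, kroneckerMap_apply]
  refine Finset.sum_congr rfl fun i _ => Finset.sum_congr rfl fun a _ => ?_
  rw [Finset.sum_eq_single i]
  · simp [blk]
  · intro j _ hj
    simp [Matrix.one_apply_ne hj.symm]
  · simp

/-- The stage cost of the nominal predictions. -/
def nomStage (S : StripedMPC nx nu nw nc N) (x : Fin nx → ℝ) (c : Fin N × Fin nu → ℝ) (i : ℕ) : ℝ :=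
  S.predState x c 0 i ⬝ᵥ S.Q *ᵥ S.predState x c 0 i
    + S.predInput x c 0 i ⬝ᵥ S.R *ᵥ S.predInput x c 0 i

/-- The expected stage cost due to a single disturbance which acted `k + 1` steps ago. -/
noncomputable def noiseStage (S : StripedMPC nx nu nw nc N) (k : ℕ) : ℝ :=
  ∫ v, (S.stateResp k *ᵥ v) ⬝ᵥ S.Q *ᵥ (S.stateResp k *ᵥ v) ∂S.ν
    + ∫ v, (S.inputResp k *ᵥ v) ⬝ᵥ S.R *ᵥ (S.inputResp k *ᵥ v) ∂S.ν

namespace Standing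

theorem costHess_posDef (hS : S.Standing) : S.costHess.PosDef :=
  Matrix.PosDef.one.kronecker hS.hess_posDef

theorem ae_norm_le (hS : S.Standing) : ∃ r, ∀ᵐ v ∂S.ν, ‖v‖ ≤ r := by
  obtain ⟨r, hr⟩ := hS.W_bdd.exists_norm_le
  exact ⟨r, hS.ν_supp.mono hr⟩

theorem integrable_resp (hS : S.Standing) {n : ℕ} (M : Matrix (Fin n) (Fin n) ℝ)
    (T : Matrix (Fin n) (Fin nw) ℝ) :
    Integrable (fun v => (T *ᵥ v) ⬝ᵥ M *ᵥ (T *ᵥ v)) S.ν := by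
  have := hS.ν_prob
  have h : ∀ v : Fin nw → ℝ, (T *ᵥ v) ⬝ᵥ M *ᵥ (T *ᵥ v) = v ⬝ᵥ (Tᵀ * M * T) *ᵥ v :=
    fun v => by rw [← mulVec_mulVec, form_transpose_mul]
  simp only [h]
  exact integrable_form (w := fun _ v => v) hS.ae_norm_le (fun _ => HasLaw.id) _ 0 0

theorem nomStage_eq (hS : S.Standing) (x : Fin nx → ℝ) (c : Fin N × Fin nu → ℝ) (i : ℕ) :
    S.nomStage x c i = S.predState x c 0 i ⬝ᵥ S.P *ᵥ S.predState x c 0 i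
      - S.predState x c 0 (i + 1) ⬝ᵥ S.P *ᵥ S.predState x c 0 (i + 1)
      + blk c i ⬝ᵥ S.hess *ᵥ blk c i := by
  have h := hS.cost_to_go (S.predState x c 0 i) (blk c i)
  rw [← predState_zero_succ, ← predInput_zero] at h
  rw [nomStage]
  linarith

/-- A state sequence which follows `A + B K` from step `N` on has geometrically decaying
cost-to-go. -/
theorem form_P_le_geometric {ρ : ℝ} (hρ : 0 < ρ)
    (h : ∀ x : Fin nx → ℝ, (S.A *ᵥ x + S.B *ᵥ (S.K *ᵥ x)) ⬝ᵥ S.P *ᵥ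
      (S.A *ᵥ x + S.B *ᵥ (S.K *ᵥ x)) ≤ ρ * (x ⬝ᵥ S.P *ᵥ x))
    (x : Fin nx → ℝ) (c : Fin N × Fin nu → ℝ) (i : ℕ) :
    S.predState x c 0 (i + N) ⬝ᵥ S.P *ᵥ S.predState x c 0 (i + N)
      ≤ (S.predState x c 0 N ⬝ᵥ S.P *ᵥ S.predState x c 0 N) * ρ ^ i := by
  induction i with
  | zero => simp
  | succ i ih =>
    rw [show i + 1 + N = i + N + 1 by ring, predState_zero_succ, blk_eq_zero c (by omega), add_zero]
    refine (h _).trans ?_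
    rw [pow_succ, ← mul_assoc, mul_comm _ ρ]
    exact mul_le_mul_of_nonneg_left ih hρ.le

theorem tendsto_form_P (hS : S.Standing) (x : Fin nx → ℝ) (c : Fin N × Fin nu → ℝ) :
    Tendsto (fun i => S.predState x c 0 i ⬝ᵥ S.P *ᵥ S.predState x c 0 i) atTop (𝓝 0) := by
  obtain ⟨ρ, hρ, hρ1, h⟩ := hS.exists_contraction
  rw [← tendsto_add_atTop_iff_nat N]
  refine squeeze_zero (fun i => hS.P_psd.form_nonneg _) (form_P_le_geometric hρ h x c) ?_
  simpa using (tendsto_pow_atTop_nhds_zero_of_lt_one hρ.le hρ1).const_mul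
    (S.predState x c 0 N ⬝ᵥ S.P *ᵥ S.predState x c 0 N)

/-- The nominal predictions converge to the origin. -/
theorem tendsto_predState (hS : S.Standing) (x : Fin nx → ℝ) (c : Fin N × Fin nu → ℝ) :
    Tendsto (fun i => S.predState x c 0 i) atTop (𝓝 0) := by
  obtain ⟨m, hm, hP⟩ := hS.P_posDef.exists_le_form
  have h : Tendsto (fun i => ‖S.predState x c 0 i‖ ^ 2) atTop (𝓝 0) := by
    refine squeeze_zero (fun i => by positivity) (fun i => ?_)
      (by simpa using (hS.tendsto_form_P x c).const_mul m⁻¹)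
    rw [inv_mul_eq_div, le_div_iff₀ hm, mul_comm]
    exact hP _
  rw [tendsto_zero_iff_norm_tendsto_zero]
  simpa using h.sqrt

/-- The nominal cost: the stage costs telescope along the completed squares. -/
theorem hasSum_nomStage (hS : S.Standing) (x : Fin nx → ℝ) (c : Fin N × Fin nu → ℝ) :
    HasSum (S.nomStage x c) (quad S.P S.costHess x c) := by
  have hnn : ∀ i, 0 ≤ S.nomStage x c i := fun i =>
    add_nonneg (hS.Q_pos.posSemidef.form_nonneg _) (hS.R_pos.posSemidef.form_nonneg _)
  rw [hasSum_iff_tendsto_nat_of_nonneg hnn]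
  have hsum : ∀ n, ∑ i ∈ Finset.range n, S.nomStage x c i
      = x ⬝ᵥ S.P *ᵥ x - S.predState x c 0 n ⬝ᵥ S.P *ᵥ S.predState x c 0 n
        + ∑ i ∈ Finset.range n, blk c i ⬝ᵥ S.hess *ᵥ blk c i := by
    intro n
    simp only [hS.nomStage_eq, Finset.sum_add_distrib]
    rw [Finset.sum_range_sub' fun i => S.predState x c 0 i ⬝ᵥ S.P *ᵥ S.predState x c 0 i]
    rfl
  have hb : HasSum (fun i => blk c i ⬝ᵥ S.hess *ᵥ blk c i) (c ⬝ᵥ S.costHess *ᵥ c) := by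
    rw [form_costHess]
    refine hasSum_sum_of_ne_finset_zero fun i hi => ?_
    rw [blk_eq_zero c (by simpa using hi), zero_dotProduct]
  simp only [hsum, quad]
  simpa using ((tendsto_const_nhds (x := x ⬝ᵥ S.P *ᵥ x)).sub (hS.tendsto_form_P x c)).add
    hb.tendsto_sum_nat

/-- The effect of a single disturbance on the expected stage cost dies out geometrically. -/
theorem exists_noiseStage_le (hS : S.Standing) :
    ∃ C ρ : ℝ, 0 ≤ ρ ∧ ρ < 1 ∧ ∀ i, |S.noiseStage (i + N)| ≤ C * ρ ^ i := by
  obtain ⟨ρ, hρ, hρ1, h⟩ := hS.exists_contraction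
  let q : ℕ → ℝ := fun k => ∫ v, (S.stateResp k *ᵥ v) ⬝ᵥ S.P *ᵥ (S.stateResp k *ᵥ v) ∂S.ν
  have hstep : ∀ k, N ≤ k + 1 → ∀ v, S.inputResp k *ᵥ v = S.K *ᵥ (S.stateResp k *ᵥ v) ∧
      S.stateResp (k + 1) *ᵥ v
        = S.A *ᵥ (S.stateResp k *ᵥ v) + S.B *ᵥ (S.K *ᵥ (S.stateResp k *ᵥ v)) := by
    intro k hk v
    simp [inputResp, stateResp, S.stripe_eq_zero hk (Nat.succ_pos k), add_mulVec]
  have hq : ∀ i, q (i + N) ≤ q N * ρ ^ i := by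
    intro i
    induction i with
    | zero => simp
    | succ i ih =>
      have h1 : q (i + 1 + N) ≤ ρ * q (i + N) := by
        simp only [q]
        rw [← integral_const_mul]
        refine integral_mono (hS.integrable_resp _ _) ((hS.integrable_resp _ _).const_mul _)
          fun v => ?_
        simp only [show i + 1 + N = i + N + 1 by ring, (hstep (i + N) (by omega) v).2]
        exact h _
      refine h1.trans ?_
      rw [pow_succ, ← mul_assoc, mul_comm _ ρ]
      exact mul_le_mul_of_nonneg_left ih hρ.le
  refine ⟨q N, ρ, hρ.le, hρ1, fun i => le_trans ?_ (hq i)⟩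
  rw [abs_of_nonneg (add_nonneg
    (integral_nonneg fun v => hS.Q_pos.posSemidef.form_nonneg _)
    (integral_nonneg fun v => hS.R_pos.posSemidef.form_nonneg _)), noiseStage,
    ← integral_add (hS.integrable_resp _ _) (hS.integrable_resp _ _)]
  refine integral_mono ((hS.integrable_resp _ _).add (hS.integrable_resp _ _))
    (hS.integrable_resp _ _) fun v => ?_
  have h1 := hS.cost_to_go (S.stateResp (i + N) *ᵥ v) 0
  simp only [add_zero, zero_dotProduct] at h1
  have h2 := hS.P_psd.form_nonneg (S.A *ᵥ (S.stateResp (i + N) *ᵥ v)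
    + S.B *ᵥ (S.K *ᵥ (S.stateResp (i + N) *ᵥ v)))
  simp only [(hstep (i + N) (by omega) v).1]
  linarith

theorem exists_tendsto_noise (hS : S.Standing) : ∃ l,
    Tendsto (fun i => ∑ k ∈ Finset.range i, S.noiseStage k) atTop (𝓝 l) ∧
      Summable fun i => ∑ k ∈ Finset.range i, S.noiseStage k - l := by
  obtain ⟨C, ρ, hρ, hρ1, h⟩ := hS.exists_noiseStage_le
  refine exists_tendsto_summable_of_geometric (C := C) hρ hρ1 N fun i => ?_
  rw [show i + 1 + N = i + N + 1 by ring, Finset.sum_range_succ, add_sub_cancel_left]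
  exact h i

section Expectation

variable {Ω : Type*} [MeasurableSpace Ω] {μ : Measure Ω} [IsProbabilityMeasure μ]
  {w : ℕ → Ω → Fin nw → ℝ}

/-- The expected stage cost splits into the nominal stage cost and a contribution of the
disturbances that does not depend on `x` and `c`. -/
theorem expStage_eq (hS : S.Standing) (hindep : iIndepFun w μ) (hlaw : ∀ i, HasLaw (w i) S.ν μ)
    (x : Fin nx → ℝ) (c : Fin N × Fin nu → ℝ) (i : ℕ) :
    Integrable (S.stage w x c i) μ ∧
      S.expStage μ w x c i = S.nomStage x c i + ∑ k ∈ Finset.range i, S.noiseStage k := by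
  have hstage : S.stage w x c i = fun ω =>
      (S.predState x c 0 i + ∑ k ∈ Finset.range i, S.stateResp k *ᵥ w (i - (k + 1)) ω) ⬝ᵥ
        S.Q *ᵥ (S.predState x c 0 i
          + ∑ k ∈ Finset.range i, S.stateResp k *ᵥ w (i - (k + 1)) ω)
      + (S.predInput x c 0 i + ∑ k ∈ Finset.range i, S.inputResp k *ᵥ w (i - (k + 1)) ω) ⬝ᵥ
        S.R *ᵥ (S.predInput x c 0 i
          + ∑ k ∈ Finset.range i, S.inputResp k *ᵥ w (i - (k + 1)) ω) := by
    funext ω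
    rw [stage, S.predState_eq x c, S.predInput_eq x c]
  obtain ⟨hQ, hQ'⟩ := integral_form_add_sum hS.ae_norm_le hS.ν_mean hindep hlaw S.Q
    (S.predState x c 0 i) S.stateResp i
  obtain ⟨hR, hR'⟩ := integral_form_add_sum hS.ae_norm_le hS.ν_mean hindep hlaw S.R
    (S.predInput x c 0 i) S.inputResp i
  rw [expStage, hstage]
  refine ⟨hQ.add hR, ?_⟩
  rw [integral_add hQ hR, hQ', hR']
  simp only [nomStage, noiseStage, Finset.sum_add_distrib]
  ring

/-- The expected stage cost converges to a limit independent of `x` and `c`, summably fast, and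
the resulting cost is a quadratic form in `(x, c)` up to a constant. -/
theorem cost_eq (hS : S.Standing) (hindep : iIndepFun w μ) (hlaw : ∀ i, HasLaw (w i) S.ν μ) :
    (∀ x c, Tendsto (S.expStage μ w x c) atTop (𝓝 (S.Lss μ w)) ∧
      Summable (fun i => S.expStage μ w x c i - S.Lss μ w)) ∧
    ∃ κ, ∀ x c, S.cost μ w x c = quad S.P S.costHess x c + κ := by
  obtain ⟨l, hl, hsum⟩ := hS.exists_tendsto_noise
  have he : ∀ x c, S.expStage μ w x c
      = fun i => S.nomStage x c i + ∑ k ∈ Finset.range i, S.noiseStage k :=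
    fun x c => funext fun i => (hS.expStage_eq hindep hlaw x c i).2
  have ht : ∀ x c, Tendsto (S.expStage μ w x c) atTop (𝓝 l) := by
    intro x c
    rw [he]
    simpa using (hS.hasSum_nomStage x c).summable.tendsto_atTop_zero.add hl
  have hL : S.Lss μ w = l := (ht 0 0).limUnder_eq
  have hs : ∀ x c, HasSum (fun i => S.expStage μ w x c i - l)
      (quad S.P S.costHess x c + ∑' i, (∑ k ∈ Finset.range i, S.noiseStage k - l)) := by
    intro x c
    simp only [he, add_sub_assoc]
    exact (hS.hasSum_nomStage x c).add hsum.hasSum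
  refine ⟨fun x c => ?_, ∑' i, (∑ k ∈ Finset.range i, S.noiseStage k - l), fun x c => ?_⟩
  · rw [hL]
    exact ⟨ht x c, (hs x c).summable⟩
  · rw [cost, hL]
    exact (hs x c).tsum_eq

end Expectation

end Standing

end StripedMPC

/-! ### The constraints -/

/-- Under a compactly supported law, a chance constraint `ℙ (h + X ≤ 1) ≥ p` on the constant `h` is
an upper bound on `h`; the bound is attained by right continuity of the distribution
function. -/
theorem exists_chance_bound {d : ℕ} {ν : Measure (Fin d → ℝ)} [IsProbabilityMeasure ν]
    (hν : ∃ r, ∀ᵐ v ∂ν, ‖v‖ ≤ r) (a : Fin d → ℝ) {p : ℝ} (hp : 0 < p) (hp1 : p ≤ 1) :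
    ∃ t, ∀ h, p ≤ ν.real {w | h + a ⬝ᵥ w ≤ 1} ↔ h ≤ t := by
  have hX : Measurable fun w : Fin d → ℝ => a ⬝ᵥ w := by
    have : Continuous fun w : Fin d → ℝ => a ⬝ᵥ w := by fun_prop
    exact this.measurable
  have := Measure.isProbabilityMeasure_map (μ := ν) hX.aemeasurable
  obtain ⟨M, hM⟩ : ∃ M, ∀ᵐ w ∂ν, |a ⬝ᵥ w| ≤ M := by
    obtain ⟨r, hr⟩ := hν
    refine ⟨∑ i, |a i| * r, hr.mono fun w hw => ?_⟩
    refine (Finset.abs_sum_le_sum_abs _ _).trans (Finset.sum_le_sum fun i _ => ?_)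
    rw [abs_mul]
    exact mul_le_mul_of_nonneg_left ((norm_le_pi_norm w i).trans hw) (abs_nonneg _)
  have hcdf : ∀ h, ν.real {w | h + a ⬝ᵥ w ≤ 1} = cdf (ν.map fun w => a ⬝ᵥ w) (1 - h) := by
    intro h
    rw [cdf_eq_real, map_measureReal_apply hX measurableSet_Iic]
    congr 1
    ext w
    simp only [Set.mem_ofPred_eq, Set.mem_preimage, Set.mem_Iic]
    constructor <;> intro <;> linarith
  let T : Set ℝ := {h | p ≤ ν.real {w | h + a ⬝ᵥ w ≤ 1}}
  have hne : T.Nonempty := by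
    refine ⟨1 - M, ?_⟩
    have : ν.real {w | 1 - M + a ⬝ᵥ w ≤ 1} = 1 := by
      have h1 : {w | 1 - M + a ⬝ᵥ w ≤ 1} =ᵐ[ν] Set.univ := by
        rw [eventuallyEq_univ]
        filter_upwards [hM] with w hw
        have := (abs_le.1 hw).2
        change 1 - M + a ⬝ᵥ w ≤ 1
        linarith
      rw [measureReal_congr h1, probReal_univ]
    change p ≤ ν.real {w | 1 - M + a ⬝ᵥ w ≤ 1}
    rwa [this]
  have hbdd : BddAbove T := by
    refine ⟨1 + M, fun h hh => ?_⟩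
    by_contra! hlt
    have : ν {w | h + a ⬝ᵥ w ≤ 1} = 0 := by
      rw [measure_eq_zero_iff_ae_notMem]
      filter_upwards [hM] with w hw
      have := (abs_le.1 hw).1
      change ¬ (h + a ⬝ᵥ w ≤ 1)
      linarith
    have hh' : p ≤ ν.real {w | h + a ⬝ᵥ w ≤ 1} := hh
    rw [measureReal_def, this] at hh'
    simp only [ENNReal.toReal_zero] at hh'
    linarith
  refine ⟨sSup T, fun h => ⟨fun hh => le_csSup hbdd hh, fun hh => ?_⟩⟩
  rw [hcdf]
  have hcont : Tendsto (cdf (ν.map fun w => a ⬝ᵥ w)) (𝓝[>] (1 - h))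
      (𝓝 (cdf (ν.map fun w => a ⬝ᵥ w) (1 - h))) :=
    ((cdf (ν.map fun w => a ⬝ᵥ w)).right_continuous (1 - h)).mono_left
      (nhdsWithin_mono _ Set.Ioi_subset_Ici_self)
  refine ge_of_tendsto hcont ?_
  filter_upwards [self_mem_nhdsWithin] with y hy
  obtain ⟨h', hh', hlt⟩ := exists_lt_of_lt_csSup hne
    (show 1 - y < sSup T by have : 1 - h < y := hy; linarith)
  have h1 : p ≤ cdf (ν.map fun w => a ⬝ᵥ w) (1 - h') := (hcdf h').symm ▸ hh'
  exact h1.trans (monotone_cdf _ (by linarith))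

namespace StripedMPC

variable {nx nu nw nc N : ℕ} {S : StripedMPC nx nu nw nc N}

namespace Standing

/-- The chance constraints are finitely many linear inequalities in `(x, c)`: each chance constraint
is an upper bound on an affine function of `(x, c)` and of the past disturbances, and the worst case
over the past disturbances only shifts the bound. -/
theorem exists_linear_constraints (hS : S.Standing) :
    ∃ (F : Fin nc × Fin (N + S.N₂) → (Fin nx → ℝ) →L[ℝ] ℝ)
      (G : Fin nc × Fin (N + S.N₂) → (Fin N × Fin nu → ℝ) →L[ℝ] ℝ)
      (b : Fin nc × Fin (N + S.N₂) → ℝ),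
      ∀ x c, S.Feasible x c ↔ ∀ k, F k x + G k c ≤ b k := by
  have := hS.ν_prob
  choose t ht using fun r => exists_chance_bound hS.ae_norm_le (S.f r ᵥ* S.D)
    (hS.p_pos r) (hS.p_le r)
  let φ : Fin nc → ℕ → (Fin nx → ℝ) × (Fin N × Fin nu → ℝ) →ₗ[ℝ] ℝ := fun r i =>
    dotProductBilin ℝ ℝ (S.f r) ∘ₗ (S.A.mulVecLin ∘ₗ S.nomState i + S.B.mulVecLin ∘ₗ S.nomInput i)
      + dotProductBilin ℝ ℝ (S.g r) ∘ₗ S.nomInput i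
  let γ : Fin nc → ℕ → (ℕ → Fin nw → ℝ) → ℝ := fun r i v =>
    S.f r ⬝ᵥ (S.A *ᵥ (∑ k ∈ Finset.range i, S.stateResp k *ᵥ v (i - (k + 1)))
        + S.B *ᵥ (∑ k ∈ Finset.range i, S.inputResp k *ᵥ v (i - (k + 1))))
      + S.g r ⬝ᵥ (∑ k ∈ Finset.range i, S.inputResp k *ᵥ v (i - (k + 1)))
  have hstep : ∀ x c i, S.StepConstraint x c i ↔
      ∀ r, ∀ v : {v : ℕ → Fin nw → ℝ // ∀ j, v j ∈ S.W}, φ r i (x, c) ≤ t r - γ r i v := by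
    intro x c i
    refine forall_congr' fun r => ⟨fun h v => ?_, fun h v hv => ?_⟩
    all_goals
      have key : ∀ v w, S.f r ⬝ᵥ (S.A *ᵥ S.predState x c v i + S.B *ᵥ S.predInput x c v i
          + S.D *ᵥ w) + S.g r ⬝ᵥ S.predInput x c v i
          = (φ r i (x, c) + γ r i v) + (S.f r ᵥ* S.D) ⬝ᵥ w := by
        intro v w
        rw [S.predState_eq x c v, S.predInput_eq x c v, ← dotProduct_mulVec]
        simp only [φ, γ, nomState, nomInput, LinearMap.add_apply, LinearMap.comp_apply,
          LinearMap.coe_mk, AddHom.coe_mk, mulVecLin_apply, dotProductBilin_apply_apply,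
          dotProduct_add, mulVec_add]
        ring
    · have h1 := h v.1 v.2
      simp only [key] at h1
      have := (ht r _).1 h1
      linarith
    · simp only [key]
      have := h ⟨v, hv⟩
      exact (ht r _).2 (by linarith)
  have hW : Nonempty {v : ℕ → Fin nw → ℝ // ∀ j, v j ∈ S.W} :=
    ⟨⟨fun _ => 0, fun _ => interior_subset hS.W_zero⟩⟩
  refine ⟨fun k => (φ k.1 k.2 ∘ₗ LinearMap.inl ℝ _ _).toContinuousLinearMap,
    fun k => (φ k.1 k.2 ∘ₗ LinearMap.inr ℝ _ _).toContinuousLinearMap,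
    fun k => ⨅ v : {v : ℕ → Fin nw → ℝ // ∀ j, v j ∈ S.W}, (t k.1 - γ k.1 k.2 v), fun x c => ?_⟩
  have hφ : ∀ k : Fin nc × Fin (N + S.N₂),
      (φ k.1 k.2 ∘ₗ LinearMap.inl ℝ _ _).toContinuousLinearMap x
      + (φ k.1 k.2 ∘ₗ LinearMap.inr ℝ _ _).toContinuousLinearMap c = φ k.1 k.2 (x, c) := by
    intro k
    simp only [LinearMap.coe_toContinuousLinearMap', LinearMap.comp_apply, LinearMap.inl_apply,
      LinearMap.inr_apply]
    rw [← map_add]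
    simp
  simp only [hφ]
  constructor
  · intro h k
    exact le_ciInf ((hstep x c k.2).1 (h k.2 k.2.2) k.1)
  · intro h i hi
    rw [hstep]
    intro r v
    -- a feasible point bounds the worst case over the past disturbances
    obtain ⟨x₀, c₀, h₀⟩ := hS.X_nonempty
    have hb : BddBelow (Set.range fun v : {v : ℕ → Fin nw → ℝ // ∀ j, v j ∈ S.W} =>
        t r - γ r i v) := by
      refine ⟨φ r i (x₀, c₀), ?_⟩
      rintro _ ⟨v, rfl⟩
      exact (hstep x₀ c₀ i).1 (h₀ i hi) r v
    exact (h (r, ⟨i, hi⟩)).trans (ciInf_le hb v)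

theorem feasible_smul_add (hS : S.Standing) {x y : Fin nx → ℝ} {c d : Fin N × Fin nu → ℝ}
    (hx : S.Feasible x c) (hy : S.Feasible y d) {a b : ℝ} (ha : 0 ≤ a) (hb : 0 ≤ b)
    (hab : a + b = 1) : S.Feasible (a • x + b • y) (a • c + b • d) := by
  obtain ⟨F, G, β, h⟩ := hS.exists_linear_constraints
  rw [h] at hx hy ⊢
  intro k
  have h1 := mul_le_mul_of_nonneg_left (hx k) ha
  have h2 := mul_le_mul_of_nonneg_left (hy k) hb
  have h3 : β k = a * β k + b * β k := by rw [← add_mul, hab, one_mul]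
  simp only [map_add, map_smul, smul_eq_mul]
  linarith

theorem isClosed_feasible (hS : S.Standing) :
    IsClosed {q : (Fin nx → ℝ) × (Fin N × Fin nu → ℝ) | S.Feasible q.1 q.2} := by
  obtain ⟨F, G, β, h⟩ := hS.exists_linear_constraints
  simp only [h, Set.ofPred_forall]
  exact isClosed_iInter fun k => isClosed_le (by fun_prop) continuous_const

theorem exists_feasible_near (hS : S.Standing) : ∃ C : ℝ, 0 ≤ C ∧ ∀ x y c, S.Feasible x c →
    y ∈ S.X → ∃ d, S.Feasible y d ∧ ‖d - c‖ ≤ C * ‖y - x‖ := by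
  obtain ⟨F, G, β, h⟩ := hS.exists_linear_constraints
  simp only [X, Set.mem_ofPred_eq, h]
  exact exists_lipschitz_selection F G β

theorem convex_X (hS : S.Standing) : Convex ℝ S.X := by
  rintro x ⟨c, hc⟩ y ⟨d, hd⟩ a b ha hb hab
  exact ⟨_, hS.feasible_smul_add hc hd ha hb hab⟩

/-- Recursive feasibility: the shifted decision vector is feasible at the nominal successor state,
because a zero disturbance is admissible and the constraints hold at all steps. -/
theorem feasible_shift (hS : S.Standing) {x : Fin nx → ℝ} {c : Fin N × Fin nu → ℝ}
    (h : S.Feasible x c) : S.Feasible (S.succState x c) (shift c) := by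
  intro i _ r v hv
  have h1 := hS.horizon x c h (i + 1) r (delay v) fun j => by
    cases j with
    | zero => exact interior_subset hS.W_zero
    | succ j => exact hv j
  have h2 : S.predInput (S.succState x c) (shift c) v i = S.predInput x c (delay v) (i + 1) := by
    rw [predInput, predInput, predState_shift, policy_shift]
  rwa [h2, predState_shift]

/-- The origin is feasible with `c = 0`: it is the limit of the nominal predictions from any feasible
state, at which, from step `N` on, the shifted decision vector is zero. -/
theorem feasible_zero (hS : S.Standing) : S.Feasible 0 0 := by
  obtain ⟨x, c, h⟩ := hS.X_nonempty
  have hblk : ∀ k i, blk (shift^[k] c) i = blk c (i + k) := by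
    intro k
    induction k with
    | zero => simp
    | succ k ih =>
      intro i
      rw [Function.iterate_succ_apply', blk_shift, ih]
      congr 1
      ring
  have hk : ∀ k, S.Feasible (S.predState x c 0 k) (shift^[k] c) := by
    intro k
    induction k with
    | zero => exact h
    | succ k ih =>
      have := hS.feasible_shift ih
      rwa [succState, hblk, zero_add, ← predState_zero_succ,
        ← Function.iterate_succ_apply' shift] at this
  have hzero : ∀ k, N ≤ k → shift^[k] c = 0 := by
    intro k hk
    ext ⟨i, l⟩
    have h1 : shift^[k] c (i, l) = blk (shift^[k] c) i l := by simp [blk]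
    rw [h1, hblk, blk_eq_zero c (by omega)]
    rfl
  have ht : Tendsto (fun k => (S.predState x c 0 k, (0 : Fin N × Fin nu → ℝ))) atTop
      (𝓝 (0, 0)) := (hS.tendsto_predState x c).prodMk_nhds tendsto_const_nhds
  have hev : ∀ᶠ k in atTop, (S.predState x c 0 k, (0 : Fin N × Fin nu → ℝ)) ∈
      {q : (Fin nx → ℝ) × (Fin N × Fin nu → ℝ) | S.Feasible q.1 q.2} := by
    filter_upwards [eventually_ge_atTop N] with k hN
    have := hk k
    rw [hzero k hN] at this
    exact this
  have h0 := hS.isClosed_feasible.mem_of_tendsto ht hev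
  rw [Set.mem_ofPred_eq] at h0
  exact h0

end Standing

end StripedMPC

/-! ### The value function -/

namespace StripedMPC

variable {nx nu nw nc N : ℕ} {S : StripedMPC nx nu nw nc N}

section

variable {Px : Matrix (Fin nx) (Fin nx) ℝ} {Pc : Matrix (Fin N × Fin nu) (Fin N × Fin nu) ℝ}

theorem quad_convex_comb (hPx : Px.IsHermitian) (hPc : Pc.IsHermitian) {a b : ℝ} (hab : a + b = 1)
    (x y : Fin nx → ℝ) (c d : Fin N × Fin nu → ℝ) :
    quad Px Pc (a • x + b • y) (a • c + b • d)
      = a * quad Px Pc x c + b * quad Px Pc y d - a * b * quad Px Pc (x - y) (c - d) := by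
  simp only [quad]
  rw [form_convex_comb hPx hab, form_convex_comb hPc hab]
  ring

/-- A positive definite quadratic cost has exactly one minimizer over the feasible decision
vectors. -/
theorem Standing.existsUnique_minimizer (hS : S.Standing) (hPx : Px.PosDef) (hPc : Pc.PosDef)
    {x : Fin nx → ℝ} (hx : x ∈ S.X) :
    ∃! c, S.Feasible x c ∧ ∀ c', S.Feasible x c' → quad Px Pc x c ≤ quad Px Pc x c' := by
  obtain ⟨c₀, h₀⟩ := hx
  obtain ⟨m, hm, hPcm⟩ := hPc.exists_le_form
  -- a sublevel set of the cost is compact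
  let s : Set (Fin N × Fin nu → ℝ) := {c | S.Feasible x c ∧ c ⬝ᵥ Pc *ᵥ c ≤ c₀ ⬝ᵥ Pc *ᵥ c₀}
  have hcl : IsClosed s := by
    have h1 : IsClosed {c | S.Feasible x c} :=
      hS.isClosed_feasible.preimage (f := fun c : Fin N × Fin nu → ℝ => (x, c)) (by fun_prop)
    exact h1.inter (isClosed_le (continuous_form Pc) continuous_const)
  have hbd : Bornology.IsBounded s := by
    rw [isBounded_iff_forall_norm_le]
    refine ⟨√(m⁻¹ * (c₀ ⬝ᵥ Pc *ᵥ c₀)), fun c hc => Real.le_sqrt_of_sq_le ?_⟩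
    rw [inv_mul_eq_div, le_div_iff₀ hm, mul_comm]
    exact (hPcm c).trans hc.2
  obtain ⟨c, hc, hmin⟩ := (Metric.isCompact_of_isClosed_isBounded hcl hbd).exists_isMinOn
    ⟨c₀, h₀, le_rfl⟩ (continuous_form Pc).continuousOn
  have hopt : ∀ c', S.Feasible x c' → quad Px Pc x c ≤ quad Px Pc x c' := by
    intro c' hc'
    refine add_le_add le_rfl ?_
    by_cases h : c' ⬝ᵥ Pc *ᵥ c' ≤ c₀ ⬝ᵥ Pc *ᵥ c₀
    · exact hmin (show c' ∈ s from ⟨hc', h⟩)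
    · exact hc.2.trans (not_le.1 h).le
  refine ⟨c, ⟨hc.1, hopt⟩, fun d hd => ?_⟩
  by_contra hne
  -- the midpoint of two distinct minimizers would be strictly better
  have h1 := hopt _ (hS.feasible_smul_add hc.1 hd.1 (a := 1 / 2) (b := 1 / 2) (by norm_num)
    (by norm_num) (by norm_num) |> fun h => by
      rwa [← add_smul, show (1 / 2 + 1 / 2 : ℝ) = 1 by norm_num, one_smul] at h)
  have h2 := quad_convex_comb hPx.isHermitian hPc.isHermitian
    (show (1 / 2 + 1 / 2 : ℝ) = 1 by norm_num) x x c d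
  rw [← add_smul, show (1 / 2 + 1 / 2 : ℝ) = 1 by norm_num, one_smul] at h2
  have h3 : 0 < quad Px Pc (x - x) (c - d) := by
    simpa [quad] using hPc.form_pos (sub_ne_zero.2 (Ne.symm hne))
  have h4 := hd.2 c hc.1
  have h5 := hopt d hd.1
  linarith

variable {Ω : Type*} [MeasurableSpace Ω] {μ : Measure Ω} {w : ℕ → Ω → Fin nw → ℝ}

namespace IsEquivalentCost

theorem existsUnique_isOptimal (h : S.IsEquivalentCost μ w Px Pc) (hS : S.Standing)
    {x : Fin nx → ℝ} (hx : x ∈ S.X) : ∃! c, S.IsOptimal μ w x c := by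
  simpa only [h.equiv] using hS.existsUnique_minimizer h.Px_pos h.Pc_pos hx

theorem isOptimal_optC (h : S.IsEquivalentCost μ w Px Pc) (hS : S.Standing)
    {x : Fin nx → ℝ} (hx : x ∈ S.X) : S.IsOptimal μ w x (S.optC μ w x) := by
  have hex := (h.existsUnique_isOptimal hS hx).exists
  rw [optC, dif_pos hex]
  exact hex.choose_spec

theorem feasible_optC (h : S.IsEquivalentCost μ w Px Pc) (hS : S.Standing)
    {x : Fin nx → ℝ} (hx : x ∈ S.X) : S.Feasible x (S.optC μ w x) :=
  (h.isOptimal_optC hS hx).1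

theorem value_le (h : S.IsEquivalentCost μ w Px Pc) (hS : S.Standing)
    {x : Fin nx → ℝ} {c : Fin N × Fin nu → ℝ} (hc : S.Feasible x c) :
    S.value μ w Px Pc x ≤ quad Px Pc x c :=
  ((h.equiv _ _).1 (h.isOptimal_optC hS ⟨c, hc⟩)).2 c hc

theorem strictConvexOn_value (h : S.IsEquivalentCost μ w Px Pc) (hS : S.Standing) :
    StrictConvexOn ℝ S.X (S.value μ w Px Pc) := by
  refine ⟨hS.convex_X, fun x hx y hy hxy a b ha hb hab => ?_⟩
  have h1 := h.value_le hS (hS.feasible_smul_add (h.feasible_optC hS hx) (h.feasible_optC hS hy)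
    ha.le hb.le hab)
  rw [quad_convex_comb h.Px_pos.isHermitian h.Pc_pos.isHermitian hab] at h1
  have h2 : 0 < quad Px Pc (x - y) (S.optC μ w x - S.optC μ w y) :=
    add_pos_of_pos_of_nonneg (h.Px_pos.form_pos (sub_ne_zero.2 hxy))
      (h.Pc_pos.posSemidef.form_nonneg _)
  have h3 : 0 < a * b * quad Px Pc (x - y) (S.optC μ w x - S.optC μ w y) := by positivity
  simp only [smul_eq_mul]
  change _ < a * quad Px Pc x (S.optC μ w x) + b * quad Px Pc y (S.optC μ w y)
  linarith

/-- The optimizer is bounded on the feasible set: a feasible decision vector at one state can be moved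
to a feasible one at any other state of the bounded set `X`. -/
theorem exists_norm_optC_le (h : S.IsEquivalentCost μ w Px Pc) (hS : S.Standing) :
    ∃ r, ∀ x ∈ S.X, ‖S.optC μ w x‖ ≤ r := by
  obtain ⟨L, hL, hnear⟩ := hS.exists_feasible_near
  obtain ⟨ρ, hρ⟩ := hS.X_bdd.exists_norm_le
  obtain ⟨C, hC, hPcC⟩ := exists_form_le Pc
  obtain ⟨m, hm, hPcm⟩ := h.Pc_pos.exists_le_form
  refine ⟨√(m⁻¹ * (C * (L * ρ) ^ 2)), fun x hx => Real.le_sqrt_of_sq_le ?_⟩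
  obtain ⟨d, hd, hdist⟩ := hnear 0 x 0 hS.feasible_zero hx
  rw [sub_zero, sub_zero] at hdist
  have h1 := h.value_le hS hd
  simp only [value, quad] at h1
  have h2 : ‖d‖ ≤ L * ρ := hdist.trans (mul_le_mul_of_nonneg_left (hρ x hx) hL)
  have h3 : C * ‖d‖ ^ 2 ≤ C * (L * ρ) ^ 2 := by gcongr
  rw [inv_mul_eq_div, le_div_iff₀ hm, mul_comm]
  have h4 := hPcm (S.optC μ w x)
  have h5 := hPcC d
  linarith

theorem exists_lipschitzOnWith_value (h : S.IsEquivalentCost μ w Px Pc) (hS : S.Standing) :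
    ∃ C : NNReal, LipschitzOnWith C (S.value μ w Px Pc) S.X := by
  obtain ⟨L, hL, hnear⟩ := hS.exists_feasible_near
  obtain ⟨ρ, hρ⟩ := hS.X_bdd.exists_norm_le
  obtain ⟨r, hr⟩ := h.exists_norm_optC_le hS
  obtain ⟨C₁, hC₁, hx₁⟩ := exists_form_sub_le Px ρ
  obtain ⟨C₂, hC₂, hc₂⟩ := exists_form_sub_le Pc (r + L * (ρ + ρ))
  have hC : 0 ≤ C₁ + C₂ * L := by positivity
  have key : ∀ x ∈ S.X, ∀ y ∈ S.X,
      S.value μ w Px Pc y - S.value μ w Px Pc x ≤ (C₁ + C₂ * L) * ‖y - x‖ := by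
    intro x hx y hy
    obtain ⟨d, hd, hdist⟩ := hnear x y _ (h.feasible_optC hS hx) hy
    have h1 := h.value_le hS hd
    have h2 := hx₁ x y (hρ x hx) (hρ y hy)
    have hxy : ‖y - x‖ ≤ ρ + ρ := (norm_sub_le _ _).trans (add_le_add (hρ y hy) (hρ x hx))
    have hρ0 : 0 ≤ ρ := (norm_nonneg x).trans (hρ x hx)
    have hdr : ‖d‖ ≤ r + L * (ρ + ρ) := by
      calc ‖d‖ = ‖S.optC μ w x + (d - S.optC μ w x)‖ := by rw [add_sub_cancel]
        _ ≤ ‖S.optC μ w x‖ + ‖d - S.optC μ w x‖ := norm_add_le _ _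
        _ ≤ _ := add_le_add (hr x hx) (hdist.trans (mul_le_mul_of_nonneg_left hxy hL))
    have h3 := hc₂ (S.optC μ w x) d ((hr x hx).trans (by
      have : 0 ≤ L * (ρ + ρ) := by positivity
      linarith)) hdr
    have h4 : C₂ * ‖d - S.optC μ w x‖ ≤ C₂ * (L * ‖y - x‖) := by gcongr
    simp only [value, quad] at h1 ⊢
    linarith
  refine ⟨⟨_, hC⟩, LipschitzOnWith.of_dist_le_mul fun x hx y hy => ?_⟩
  rw [Real.dist_eq, dist_eq_norm, abs_le]
  have h1 := key x hx y hy
  have h2 := key y hy x hx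
  rw [norm_sub_rev] at h1
  change -((C₁ + C₂ * L) * ‖x - y‖) ≤ _ ∧ _ ≤ (C₁ + C₂ * L) * ‖x - y‖
  constructor <;> linarith

theorem value_zero (h : S.IsEquivalentCost μ w Px Pc) (hS : S.Standing) :
    S.value μ w Px Pc 0 = 0 := by
  refine le_antisymm ((h.value_le hS hS.feasible_zero).trans_eq (by simp [quad])) ?_
  exact add_nonneg (h.Px_pos.posSemidef.form_nonneg _) (h.Pc_pos.posSemidef.form_nonneg _)

theorem isRegularOn_value (h : S.IsEquivalentCost μ w Px Pc) (hS : S.Standing) :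
    IsRegularOn (S.value μ w Px Pc) S.X where
  strictConvex := h.strictConvexOn_value hS
  zero_mem := ⟨0, hS.feasible_zero⟩
  map_zero := h.value_zero hS
  pos _ _ hx := add_pos_of_pos_of_nonneg (h.Px_pos.form_pos hx)
    (h.Pc_pos.posSemidef.form_nonneg _)
  lipschitz := h.exists_lipschitzOnWith_value hS

end IsEquivalentCost

theorem closedLoop_zero (x : Fin nx → ℝ) :
    S.closedLoop μ w x 0 = S.succState x (S.optC μ w x) := by
  simp only [closedLoop, succState, add_mulVec, mulVec_add, ← mulVec_mulVec, mulVec_zero, add_zero]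
  abel

/-- The decrease form is the stage cost of the optimal input, with `R` replaced by `Y` in the term
quadratic in `c*_0(x)`. -/
theorem decreaseForm_eq (Y : Matrix (Fin nu) (Fin nu) ℝ) (x : Fin nx → ℝ) :
    S.decreaseForm μ w Y x = x ⬝ᵥ S.Q *ᵥ x
      + (S.K *ᵥ x + blk (S.optC μ w x) 0) ⬝ᵥ S.R *ᵥ (S.K *ᵥ x + blk (S.optC μ w x) 0)
      - blk (S.optC μ w x) 0 ⬝ᵥ S.R *ᵥ blk (S.optC μ w x) 0
      + blk (S.optC μ w x) 0 ⬝ᵥ Y *ᵥ blk (S.optC μ w x) 0 := by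
  have hK : ∀ y, x ⬝ᵥ S.Kᵀ *ᵥ y = (S.K *ᵥ x) ⬝ᵥ y := fun y => by
    rw [dotProduct_mulVec, vecMul_transpose]
  rw [decreaseForm, fromBlocks_mulVec, sumElim_dotProduct_sumElim]
  simp only [Sum.elim_comp_inl, Sum.elim_comp_inr, add_mulVec, dotProduct_add, add_dotProduct,
    mulVec_add, ← mulVec_mulVec, hK]
  ring

theorem form_costHess_shift (c : Fin N × Fin nu → ℝ) :
    shift c ⬝ᵥ S.costHess *ᵥ shift c
      = c ⬝ᵥ S.costHess *ᵥ c - blk c 0 ⬝ᵥ S.hess *ᵥ blk c 0 := by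
  have h := Finset.sum_range_succ' (fun i => blk c i ⬝ᵥ S.hess *ᵥ blk c i) N
  rw [Finset.sum_range_succ, blk_eq_zero c le_rfl, zero_dotProduct, add_zero] at h
  simp only [form_costHess, blk_shift]
  linarith

/-- The decrease of the value function for the weight `a` on the decision vector, from the candidate
given by the shifted optimizer. -/
theorem IsEquivalentCost.valueDiff_le {a : ℝ} (h : S.IsEquivalentCost μ w S.P (a • S.costHess))
    (hS : S.Standing) {x : Fin nx → ℝ} (hx : x ∈ S.X) :
    S.valueDiff μ w S.P (a • S.costHess) x 0 ≤ -S.decreaseForm μ w (S.R + (a - 1) • S.hess) x := by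
  have h1 := h.value_le hS (hS.feasible_shift (h.feasible_optC hS hx))
  have h2 := hS.cost_to_go x (blk (S.optC μ w x) 0)
  rw [valueDiff, closedLoop_zero, decreaseForm_eq]
  simp only [value, quad, succState, smul_mulVec, dotProduct_smul, smul_eq_mul, form_costHess_shift,
    add_mulVec, dotProduct_add] at h1 h2 ⊢
  linarith

end

end StripedMPC

namespace StripedMPC

variable {nx nu nw nc N : ℕ} {S : StripedMPC nx nu nw nc N}
  {Ω : Type*} [MeasurableSpace Ω] {μ : Measure Ω} {w : ℕ → Ω → Fin nw → ℝ}

/-- The minimizer over `c` only depends on the second quadratic form, up to a positive factor. -/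
theorem Standing.isEquivalentCost (hS : S.Standing) {κ : ℝ}
    (hcost : ∀ x c, S.cost μ w x c = quad S.P S.costHess x c + κ) {a : ℝ} (ha : 0 < a) :
    S.IsEquivalentCost μ w S.P (a • S.costHess) where
  Px_pos := hS.P_posDef
  Pc_pos := hS.costHess_posDef.smul ha
  equiv x c := by
    refine and_congr_right fun _ => forall₂_congr fun c' _ => ?_
    simp only [hcost, quad, smul_mulVec, dotProduct_smul, smul_eq_mul, add_le_add_iff_right,
      add_le_add_iff_left, mul_le_mul_iff_right₀ ha]

theorem Standing.decreaseForm_le (hS : S.Standing) (x : Fin nx → ℝ) :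
    S.decreaseForm μ w (S.R + S.Bᵀ * S.P * S.B) x
      ≤ S.decreaseForm μ w (S.R + (2 - 1 : ℝ) • S.hess) x := by
  have h := hS.R_pos.posSemidef.form_nonneg (blk (S.optC μ w x) 0)
  rw [decreaseForm_eq, decreaseForm_eq, show (2 - 1 : ℝ) = 1 by norm_num, one_smul]
  simp only [hess, add_mulVec, dotProduct_add]
  linarith

end StripedMPC

theorem mainTheorem9 {nx nu nw nc N : ℕ} (S : StripedMPC nx nu nw nc N) (hS : S.Standing)
    {Ω : Type*} [MeasurableSpace Ω] (μ : Measure Ω) [IsProbabilityMeasure μ]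
    (w : ℕ → Ω → Fin nw → ℝ) (hindep : iIndepFun w μ) (hlaw : ∀ i, HasLaw (w i) S.ν μ) :
    -- the cost `J` is well defined
    (∀ x c, (∀ i, Integrable (S.stage w x c i) μ) ∧
      Tendsto (S.expStage μ w x c) atTop (𝓝 (S.Lss μ w)) ∧
      Summable (fun i => S.expStage μ w x c i - S.Lss μ w)) ∧
    -- the optimal control problem has a unique solution, and the nominal successor is feasible
    (∀ x ∈ S.X, (∃! c, S.IsOptimal μ w x c) ∧ S.closedLoop μ w x 0 ∈ S.X) ∧
    -- matrices for which the quadratic cost is `J` up to an additive constant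
    (∃ Px Pc, S.IsEquivalentCost μ w Px Pc ∧
      (∃ κ : ℝ, ∀ x c, S.cost μ w x c = StripedMPC.quad Px Pc x c + κ) ∧
      (∀ x ∈ S.X, S.valueDiff μ w Px Pc x 0 ≤ -S.decreaseForm μ w S.R x) ∧
      StripedMPC.IsRegularOn (S.value μ w Px Pc) S.X) ∧
    -- matrices for which the decrease bound holds with `R + Bᵀ Px B` in the last block
    (∃ Px Pc, S.IsEquivalentCost μ w Px Pc ∧
      (∀ x ∈ S.X,
        S.valueDiff μ w Px Pc x 0 ≤ -S.decreaseForm μ w (S.R + S.Bᵀ * Px * S.B) x) ∧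
      StripedMPC.IsRegularOn (S.value μ w Px Pc) S.X) := by
  obtain ⟨hlim, κ, hκ⟩ := hS.cost_eq hindep hlaw
  have h₁ := hS.isEquivalentCost hκ one_pos
  have h₂ := hS.isEquivalentCost hκ two_pos
  have d₁ := fun x (hx : x ∈ S.X) => h₁.valueDiff_le hS hx
  have d₂ := fun x (hx : x ∈ S.X) => h₂.valueDiff_le hS hx
  rw [one_smul] at h₁ d₁
  rw [sub_self, zero_smul, add_zero] at d₁
  refine ⟨fun x c => ⟨fun i => (hS.expStage_eq hindep hlaw x c i).1, hlim x c⟩,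
    fun x hx => ⟨h₁.existsUnique_isOptimal hS hx, ?_⟩,
    ⟨S.P, S.costHess, h₁, ⟨κ, hκ⟩, d₁, h₁.isRegularOn_value hS⟩,
    S.P, (2 : ℝ) • S.costHess, h₂, fun x hx => ?_, h₂.isRegularOn_value hS⟩
  · rw [StripedMPC.closedLoop_zero]
    exact ⟨_, hS.feasible_shift (h₁.feasible_optC hS hx)⟩
  · exact (d₂ x hx).trans (neg_le_neg (hS.decreaseForm_le x))
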